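/- **Setting.** Let $\mathcal S,\mathcal A$ be finite, $0\le\gamma<1$, $T,M\ge 1$, $p\ge 0$. For $t=1,\dots,T$ let $\mathcal M_t$ be a constrained Markov decision process with states $\mathcal S$, actions $\mathcal A$, discount $\gamma$, initial distribution $\rho_t$, transition kernel $P_t$, a reward $c_{t,0}$ and costs $c_{t,1},\dots,c_{t,p}$ on $\mathcal S\times\mathcal A$ with values in $[0,1]$, and limits $d_{t,1},\dots,d_{t,p}$. Let $J_{t,i}(\pi)$ be the expected total discounted value of $c_{t,i}$ under the policy $\pi$, started from $\rho_t$, and let $Q^i_{t,\pi}$ be the action-value function. Let $\pi_t^*$ be any maximizer of $J_{t,0}$ over the stationary policies with $J_{t,i}(\pi)\le d_{t,i}$ for all $i\ge1$, let $\nu_t^*(s)=(1-\gamma)\sum_{m\ge 0}\gamma^m\Pr(s_m=s\mid \pi_t^*,\rho_t)$, and let $f_t(\phi)=\mathbb E_{s\sim\nu_t^*}[D_{KL}(\pi_t^*(\cdot|s)\,|\,\phi(\cdot|s))]$. **Meta-initialization.** Fix $\varrho>0$, and let $\Pi_\varrho$ be the set of policies $\phi$ with $\phi(a|s)\ge\varrho$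 for all $s,a$. The decision variable is either $\phi\in\Pi_\varrho$ itself or its softmax logits, normalized to sum $0$ at each state; let $K\subset\mathbb R^{\mathcal S\times\mathcal A}$ be the corresponding set of decisions, and regard each $f_t$ as a function of the decision. Let $L_g,\mu_\pi>0$ be such that for every $t$ the gradient of $f_t$ has Euclidean norm at most $L_g$ on $K$ and $f_t$ is $\mu_\pi$-strongly convex on $K$. Put $$D^{*2}=\min_{\phi\in\Pi_\varrho}\frac1T\sum_{t=1}^T f_t(\phi),\qquad X=\frac{L_g^2(\log T+1)}{\mu_\pi T}+D^{*2},\qquad \kappa=\max\Big\{1,\frac{1}{16|\mathcal S||\mathcal A|(1-\gamma)}\Big\}.$$ The initializations $\pi_{1,0},\dots,\pi_{T,0}\in\Pi_\varrho$ are played on $f_1,\dots,f_T$ (with $\pi_t^*$ and $\nu_t^*$ revealed after task $t$) either by projected online gradient descent over $K$ with step size $1/(\mu_\pi t)$ after round $t$ and an arbitrary first decision, or by follow-the-regularized-leader over $K$ with a convex regularizer $R$ such that $\sup_KR-\inf_KR\le L_g^2(\log T+1)/(2\mu_\pi)$ (for instance $R=0$). **Within-task algorithm.** In task $t$, run $M$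 steps of CRPO with exact action-value functions from $\pi_{t,0}$, with learning rate and tolerance $$\alpha=\frac{(1-\gamma)^{3/2}}{\sqrt{2M|\mathcal S||\mathcal A|}}\sqrt X,\qquad \eta_t=\frac1{\alpha M}\Big(f_t(\pi_{t,0})+\kappa\,\frac{2M\alpha^2|\mathcal S||\mathcal A|}{(1-\gamma)^3}\Big).$$ That is, for $m=0,\dots,M-1$: if $J_{t,i}(\pi_{t,m})\le d_{t,i}+\eta_t$ for all $i\ge1$, then $m$ is put into $\mathcal N_{t,0}$ and the softmax logits of $\pi_{t,m}$ are increased by $\frac{\alpha}{1-\gamma}Q^0_{t,\pi_{t,m}}$ (natural gradient ascent on the reward); otherwise an arbitrary $i\ge1$ with $J_{t,i}(\pi_{t,m})>d_{t,i}+\eta_t$ is chosen and the logits are decreased by $\frac{\alpha}{1-\gamma}Q^i_{t,\pi_{t,m}}$. The output $\hat\pi_t$ is drawn uniformly from $\{\pi_{t,m}:m\in\mathcal N_{t,0}\}$. **Claim.** Each $\mathcal N_{t,0}$ is non-empty, so that $\hat\pi_t$ is well defined, and the task-averaged optimality gap $\bar R_0=\frac1T\sum_{t}\big(J_{t,0}(\pi_t^*)-\mathbb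 E[J_{t,0}(\hat\pi_t)]\big)$ and the task-averaged constraint violations $\bar R_i=\frac1T\sum_t\big(\mathbb E[J_{t,i}(\hat\pi_t)]-d_{t,i}\big)$, $1\le i\le p$, satisfy $$\bar R_i\le \kappa\,\sqrt{\frac{8|\mathcal S||\mathcal A|}{M(1-\gamma)^3}}\;\sqrt{\frac{L_g^2(\log T+1)}{\mu_\pi T}+D^{*2}},\qquad i=0,1,\dots,p.$$ In particular the bound holds without $\kappa$ (that is, $\kappa=1$) whenever $1/(1-\gamma)\le 16|\mathcal S||\mathcal A|$. -/

import Mathlib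

noncomputable section

/-- A constrained Markov decision process with finite state space `S`, finite action space `A` and
`p` constraints. Signal `0` is the reward, signals `1, …, p` are the costs, and `limit j` is the
bound on the expected total cost `j + 1`. The discount factor is shared by all tasks and is
therefore kept outside. -/
structure CMDP (S A : Type*) [Fintype S] [Fintype A] (p : ℕ) where
  init : S → ℝ
  init_nonneg : ∀ s, 0 ≤ init s
  init_sum : ∑ s, init s = 1
  trans : S → A → S → ℝ
  trans_nonneg : ∀ s a s', 0 ≤ trans s a s'
  trans_sum : ∀ s a, ∑ s', trans s a s' = 1
  signal : Fin (p + 1) → S → A → ℝ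
  signal_nonneg : ∀ i s a, 0 ≤ signal i s a
  signal_le_one : ∀ i s a, signal i s a ≤ 1
  limit : Fin p → ℝ

/-- Stationary stochastic policies, all of whose action probabilities are at least `ϱ`. For `ϱ = 0`
this is the set of all policies, for `ϱ > 0` the product over the states of the shrinkage
simplices. -/
def policySet (S A : Type*) [Fintype A] (ϱ : ℝ) : Set (S → A → ℝ) :=
  {π | ∀ s, (∀ a, ϱ ≤ π s a) ∧ ∑ a, π s a = 1}

/-- The softmax policy with logits `θ`. -/
def softmaxPolicy {S A : Type*} [Fintype A] (θ : S → A → ℝ) : S → A → ℝ :=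
  fun s a => Real.exp (θ s a) / ∑ b, Real.exp (θ s b)

/-- Kullback-Leibler divergence of two distributions on a finite set (`q` is positive in all
uses, and the summands with `P a = 0` vanish). -/
def finKL {A : Type*} [Fintype A] (P q : A → ℝ) : ℝ :=
  ∑ a, P a * Real.log (P a / q a)

namespace CMDP

variable {S A : Type*} [Fintype S] [Fintype A] {p : ℕ}

/-- Law of the state-action pair at time `m`, when the pair at time `0` has law `w` and the policy
`π` is followed from time `1` on. -/
def pairLaw (C : CMDP S A p) (π : S → A → ℝ) (w : S → A → ℝ) : ℕ → S → A → ℝ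
  | 0 => w
  | m + 1 => fun s' a' => (∑ s, ∑ a, pairLaw C π w m s a * C.trans s a s') * π s' a'

/-- Expected discounted sum of the signal `i` when the first pair has law `w`. -/
def discountedSum (γ : ℝ) (C : CMDP S A p) (i : Fin (p + 1)) (π w : S → A → ℝ) : ℝ :=
  ∑' m : ℕ, γ ^ m * ∑ s, ∑ a, C.pairLaw π w m s a * C.signal i s a

variable [DecidableEq S] [DecidableEq A]

/-- Law of `(s₀, a₀)` for a fixed `s₀` and `a₀` drawn from the policy. -/
def startAt (π : S → A → ℝ) (s₀ : S) : S → A → ℝ :=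
  fun s a => if s = s₀ then π s a else 0

/-- State-value function. -/
def stateValue (γ : ℝ) (C : CMDP S A p) (i : Fin (p + 1)) (π : S → A → ℝ) (s₀ : S) : ℝ :=
  discountedSum γ C i π (startAt π s₀)

/-- Action-value function. -/
def actionValue (γ : ℝ) (C : CMDP S A p) (i : Fin (p + 1)) (π : S → A → ℝ) (s₀ : S) (a₀ : A) : ℝ :=
  discountedSum γ C i π (fun s a => if s = s₀ ∧ a = a₀ then 1 else 0)

/-- Expected total reward (`i = 0`) or cost (`i ≥ 1`). -/
def total (γ : ℝ) (C : CMDP S A p) (i : Fin (p + 1)) (π : S → A → ℝ) : ℝ :=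
  ∑ s, C.init s * stateValue γ C i π s

/-- Discounted state visitation distribution, for the initial state distribution of `C`. -/
def visitation (γ : ℝ) (C : CMDP S A p) (π : S → A → ℝ) (s : S) : ℝ :=
  ∑ s₀, C.init s₀ * ((1 - γ) * ∑' m : ℕ, γ ^ m * ∑ a, C.pairLaw π (startAt π s₀) m s a)

/-- The policy satisfies all constraints. -/
def IsFeasible (γ : ℝ) (C : CMDP S A p) (π : S → A → ℝ) : Prop :=
  π ∈ policySet S A 0 ∧ ∀ j : Fin p, total γ C j.succ π ≤ C.limit j

/-- The policy solves the constrained problem. -/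
def IsOptimal (γ : ℝ) (C : CMDP S A p) (π : S → A → ℝ) : Prop :=
  IsFeasible γ C π ∧ ∀ π', IsFeasible γ C π' → total γ C 0 π' ≤ total γ C 0 π

/-- `𝔼_{s ∼ ν*} [KL (π* | φ)]`, with `ν*` the visitation distribution of `π*`. -/
def initLoss (γ : ℝ) (C : CMDP S A p) (πs φ : S → A → ℝ) : ℝ :=
  ∑ s, visitation γ C πs s * finKL (πs s) (φ s)

/-- `M` steps of CRPO with exact critic, learning rate `α`, tolerance `η` and initial policy `φ`.
`θ m` are the softmax logits of the `m`-th policy, and `sel m` is the signal that step `m` works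
on: the reward if every constraint holds up to `η`, otherwise an arbitrary one of the constraints
that are violated by more than `η`. The step is natural gradient ascent on the reward,
respectively descent on the cost; for the softmax parametrization the natural gradient of signal `i`
is, at every state that the policy visits, the action-value function divided by `1 - γ`, up to a
shift of the logits at the state that does not change the policy. -/
structure IsCRPORun (γ : ℝ) (C : CMDP S A p) (α η : ℝ) (M : ℕ) (φ : S → A → ℝ)
    (θ : ℕ → S → A → ℝ) (sel : ℕ → Fin (p + 1)) : Prop where
  start : softmaxPolicy (θ 0) = φ
  select : ∀ m < M,
    (sel m = 0 ∧ ∀ j : Fin p, total γ C j.succ (softmaxPolicy (θ m)) ≤ C.limit j + η) ∨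
    ∃ j : Fin p, sel m = j.succ ∧ C.limit j + η < total γ C j.succ (softmaxPolicy (θ m))
  step : ∀ m < M, ∀ s a,
    θ (m + 1) s a = θ m s a + (if sel m = 0 then 1 else -1) * α *
      (actionValue γ C (sel m) (softmaxPolicy (θ m)) s a / (1 - γ))

/-- The steps of a run at which the reward is maximized. -/
def rewardSteps (M : ℕ) (sel : ℕ → Fin (p + 1)) : Finset ℕ :=
  (Finset.range M).filter (fun m => sel m = 0)

/-- `𝔼 [J i (π̂)]`, where the output `π̂` is drawn uniformly from the policies at the steps at which
the reward is maximized. -/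
def outputTotal (γ : ℝ) (C : CMDP S A p) (M : ℕ) (θ : ℕ → S → A → ℝ) (sel : ℕ → Fin (p + 1))
    (i : Fin (p + 1)) : ℝ :=
  (∑ m ∈ rewardSteps M sel, total γ C i (softmaxPolicy (θ m))) / ((rewardSteps M sel).card : ℝ)

/-- Task-averaged optimality gap. -/
def taog {T : ℕ} (γ : ℝ) (C : Fin T → CMDP S A p) (πs : Fin T → S → A → ℝ) (M : ℕ)
    (θ : Fin T → ℕ → S → A → ℝ) (sel : Fin T → ℕ → Fin (p + 1)) : ℝ :=
  (1 / (T : ℝ)) * ∑ t, (total γ (C t) 0 (πs t) - outputTotal γ (C t) M (θ t) (sel t) 0)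

/-- Task-averaged violation of constraint `j`. -/
def tacv {T : ℕ} (γ : ℝ) (C : Fin T → CMDP S A p) (M : ℕ)
    (θ : Fin T → ℕ → S → A → ℝ) (sel : Fin T → ℕ → Fin (p + 1)) (j : Fin p) : ℝ :=
  (1 / (T : ℝ)) * ∑ t, (outputTotal γ (C t) M (θ t) (sel t) j.succ - (C t).limit j)

/-- The task similarity `D*²`: the least average loss of one common initial policy whose action
probabilities are all at least `ϱ`. (For `ϱ > 0` the infimum is over a compact set on which the
average loss is continuous and nonnegative.) -/
def taskSimilaritySq {T : ℕ} (γ ϱ : ℝ) (C : Fin T → CMDP S A p) (πs : Fin T → S → A → ℝ) : ℝ :=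
  ⨅ φ : policySet S A ϱ, (1 / (T : ℝ)) * ∑ t, initLoss γ (C t) (πs t) φ

end CMDP

/-- The decision variable of the meta-learner: the action probabilities or the softmax logits. -/
inductive DecisionVariable where
  | probabilities
  | logits

namespace DecisionVariable

variable {S A : Type*} [Fintype S] [Fintype A]

/-- The policy that a decision stands for. -/
def toPolicy (v : DecisionVariable) (x : EuclideanSpace ℝ (S × A)) : S → A → ℝ :=
  match v with
  | probabilities => fun s a => x (s, a)
  | logits => softmaxPolicy (fun s a => x (s, a))

/-- The decisions whose policy has action probabilities at least `ϱ`. Adding a constant to the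
logits at a state does not change the softmax policy, so the logits are normalized to have sum `0`
at each state; every policy with positive probabilities then has exactly one logit vector. -/
def decisionSet (v : DecisionVariable) (S A : Type*) [Fintype S] [Fintype A] (ϱ : ℝ) :
    Set (EuclideanSpace ℝ (S × A)) :=
  match v with
  | probabilities => {x | probabilities.toPolicy x ∈ policySet S A ϱ}
  | logits => {x | (∀ s, ∑ a, x (s, a) = 0) ∧ logits.toPolicy x ∈ policySet S A ϱ}

end DecisionVariable

section OnlineLearning

variable {E : Type*} [NormedAddCommGroup E] [InnerProductSpace ℝ E] [CompleteSpace E] {T : ℕ}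

/-- Projected online gradient descent on the losses `f` over `K` with step size `1 / (μ t)` after
round `t`, from an arbitrary first decision; the rounds `1, …, T` are the elements of `Fin T`. -/
def IsOGD (K : Set E) (f : Fin T → E → ℝ) (μ : ℝ) (x : Fin T → E) : Prop :=
  (∀ t, x t ∈ K) ∧
  ∀ s t : Fin T, (t : ℕ) = (s : ℕ) + 1 → ∀ y ∈ K,
    ‖x t - (x s - (1 / (μ * ((s : ℝ) + 1))) • gradient (f s) (x s))‖ ≤
      ‖y - (x s - (1 / (μ * ((s : ℝ) + 1))) • gradient (f s) (x s))‖

/-- Follow-the-regularized-leader with regularizer `R`: each decision minimizes over `K` the sum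
of `R` and of the losses of the earlier rounds. -/
def IsFTRL (K : Set E) (f : Fin T → E → ℝ) (R : E → ℝ) (x : Fin T → E) : Prop :=
  ∀ t, x t ∈ K ∧
    IsMinOn (fun y => (∑ s ∈ Finset.univ.filter (fun s => s < t), f s y) + R y) K (x t)

end OnlineLearning

/-- `L² (log T + 1) / (μ T) + D²`. -/
def similarityScale (T : ℕ) (L μ Dsq : ℝ) : ℝ :=
  L ^ 2 * (Real.log T + 1) / (μ * T) + Dsq

/-- The learning rate of CRPO, where `X = similarityScale …`, `nS = |S|` and `nA = |A|`. -/
def crpoRate (γ : ℝ) (M nS nA : ℕ) (X : ℝ) : ℝ :=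
  (1 - γ) ^ (3 / 2 : ℝ) / √(2 * M * nS * nA) * √X

/-- `max {1, 1 / (16 |S| |A| (1 - γ))}`: this is `1` unless the effective horizon `1 / (1 - γ)`
exceeds `16 |S| |A|`. -/
def horizonFactor (γ : ℝ) (nS nA : ℕ) : ℝ :=
  max 1 (1 / (16 * nS * nA * (1 - γ)))

/-- The tolerance of CRPO for a task with initial loss `ℓ`. -/
def crpoTolerance (γ α : ℝ) (M nS nA : ℕ) (ℓ : ℝ) : ℝ :=
  1 / (α * M) *
    (ℓ + horizonFactor γ nS nA * (2 * M * α ^ 2 * nS * nA / (1 - γ) ^ 3))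

end

/-! Within a task, `initLoss` to the optimal policy `π*` is a potential. A natural gradient step on
softmax logits is a multiplicative-weights step with exponents proportional to `Q`. By Hoeffding's
lemma and the performance difference lemma it lowers the potential by `± α (J_i(π*) - J_i(π_m))`, up
to `α² / (8 (1 - γ)⁴)` (`initLoss_step`). Telescoping, the signed gaps sum to at most `M η_t`: the
tolerance is the initial loss plus a bound for the second-order terms, over `α M`. As `π*` is
feasible, every cost step has gap greater than `η_t`. Hence not all steps are cost steps, and over
the reward steps the average gap is at most `η_t`; there the constraints hold up to `η_t` by
selection (`IsCRPORun.guarantee`).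

Across tasks, `η_t` is affine in the loss of the initialization, so only the average initial loss
matters. Logarithmic regret on strongly convex losses (`meta_regret`) bounds it by `X`. The rate `α`
makes the second-order term equal to `X` before the factor `κ`, so the average tolerance is at most
`(X + κ X) / (α M) ≤ 2 κ X / (α M)`, which is the claimed bound. -/

/-! ### Strong convexity -/

open scoped RealInnerProductSpace in
/-- Linear lower bound with a quadratic term for strongly convex functions. -/
theorem StrongConvexOn.inner_gradient_add_le {E : Type*} [NormedAddCommGroup E]
    [InnerProductSpace ℝ E] [CompleteSpace E] {K : Set E} {f : E → ℝ} {μ : ℝ}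
    (hf : StrongConvexOn K μ f) {x y : E} (hx : x ∈ K) (hy : y ∈ K)
    (hd : DifferentiableAt ℝ f x) :
    f x + ⟪gradient f x, y - x⟫ + μ / 2 * ‖y - x‖ ^ 2 ≤ f y := by
  have hline : HasDerivAt (fun t : ℝ => f (x + t • (y - x))) ⟪gradient f x, y - x⟫ 0 := by
    have h1 : HasDerivAt (fun t : ℝ => x + t • (y - x)) (y - x) 0 := by
      simpa using ((hasDerivAt_id (0 : ℝ)).smul_const (y - x)).const_add x
    have h2 : HasFDerivAt f (InnerProductSpace.toDual ℝ E (gradient f x))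
        (x + (0 : ℝ) • (y - x)) := by simpa using hd.hasGradientAt.hasFDerivAt
    exact h2.comp_hasDerivAt (0 : ℝ) h1
  -- Divide the strong convexity inequality at `x + t (y - x)` by `t` and let `t` decrease to `0`.
  have hslope := hline.tendsto_slope_zero_right
  have hright : Filter.Tendsto (fun t : ℝ => f y - f x - (1 - t) * (μ / 2 * ‖y - x‖ ^ 2))
      (nhdsWithin 0 (Set.Ioi 0)) (nhds (f y - f x - (1 - 0) * (μ / 2 * ‖y - x‖ ^ 2))) :=
    ((by fun_prop : Continuous fun t : ℝ =>
      f y - f x - (1 - t) * (μ / 2 * ‖y - x‖ ^ 2)).tendsto 0).mono_left nhdsWithin_le_nhds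
  have key := le_of_tendsto_of_tendsto hslope hright (by
    filter_upwards [Ioo_mem_nhdsGT (zero_lt_one' ℝ)] with t ht
    have h := hf.2 hx hy (show (0 : ℝ) ≤ 1 - t by linarith [ht.2]) ht.1.le (by ring)
    have he : (1 - t) • x + t • y = x + t • (y - x) := by
      rw [sub_smul, smul_sub, one_smul]; abel
    rw [he, norm_sub_rev] at h
    simp only [smul_eq_mul] at h ⊢
    rw [zero_add, zero_smul, add_zero, inv_mul_le_iff₀ ht.1]
    nlinarith [h])
  linarith

/-- A minimizer over a convex set of a function that satisfies the strong convexity inequality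
at the minimizer has quadratic growth. -/
theorem quadratic_growth_of_isMinOn {E : Type*} [NormedAddCommGroup E] [NormedSpace ℝ E]
    {K : Set E} (hK : Convex ℝ K) {F : E → ℝ} {m : ℝ} {x y : E} (hx : x ∈ K) (hy : y ∈ K)
    (hF : ∀ a b : ℝ, 0 ≤ a → 0 ≤ b → a + b = 1 →
      F (a • x + b • y) ≤ a * F x + b * F y - a * b * (m / 2 * ‖x - y‖ ^ 2))
    (hmin : ∀ z ∈ K, F x ≤ F z) : F x + m / 2 * ‖x - y‖ ^ 2 ≤ F y := by
  have hlim : Filter.Tendsto (fun t : ℝ => (1 - t) * (m / 2 * ‖x - y‖ ^ 2))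
      (nhdsWithin 0 (Set.Ioi 0)) (nhds ((1 - 0) * (m / 2 * ‖x - y‖ ^ 2))) :=
    ((by fun_prop : Continuous fun t : ℝ =>
      (1 - t) * (m / 2 * ‖x - y‖ ^ 2)).tendsto 0).mono_left nhdsWithin_le_nhds
  -- Minimality against `(1 - t) x + t y`, combined with `hF` and divided by `t`; then `t` decreases
  -- to `0`.
  have key := le_of_tendsto hlim (b := F y - F x) (by
    filter_upwards [Ioo_mem_nhdsGT (zero_lt_one' ℝ)] with t ht
    have h1 : (0 : ℝ) ≤ 1 - t := by linarith [ht.2]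
    have h := hF (1 - t) t h1 ht.1.le (by ring)
    have h' := hmin _ (hK hx hy h1 ht.1.le (by ring))
    refine le_of_mul_le_mul_left ?_ ht.1
    nlinarith)
  linarith

/-! ### Logarithmic regret of gradient descent and of follow-the-regularized-leader -/

section Regret

open scoped RealInnerProductSpace

variable {E : Type*} [NormedAddCommGroup E] [InnerProductSpace ℝ E]

/-- Complete the square. It absorbs the linear loss of a round into the accumulated strong
convexity. -/
theorem norm_mul_sub_le_sq_div {L μ d : ℝ} (hμ : 0 < μ) :
    L * d - μ / 2 * d ^ 2 ≤ L ^ 2 / (2 * μ) := by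
  rw [le_div_iff₀ (by positivity)]
  nlinarith [sq_nonneg (L - μ * d)]

/-- Partial regret bound of projected gradient descent, with the potential term. -/
theorem ogd_partial_regret {f : ℕ → E → ℝ} {G x : ℕ → E} {L μ : ℝ} {T : ℕ}
    (hμ : 0 < μ) (hG : ∀ n < T, ‖G n‖ ≤ L) {y : E}
    (hf : ∀ n < T, f n (x n) - f n y ≤ ⟪G n, x n - y⟫ - μ / 2 * ‖x n - y‖ ^ 2)
    (hstep : ∀ n, n + 1 < T →
      ‖x (n + 1) - y‖ ^ 2 ≤ ‖x n - (1 / (μ * (n + 1))) • G n - y‖ ^ 2) (n : ℕ) (hn : n < T) :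
    ∑ k ∈ Finset.range n, (f k (x k) - f k y) ≤
      L ^ 2 / (2 * μ) * ∑ k ∈ Finset.range n, ((k : ℝ) + 1)⁻¹ - μ * n / 2 * ‖x n - y‖ ^ 2 := by
  induction n with
  | zero => simp
  | succ n ih =>
    have hn' : n < T := by omega
    rw [Finset.sum_range_succ, Finset.sum_range_succ]
    have h1 := ih hn'
    have h2 := hf n hn'
    have h3 := hstep n hn
    have hpos : (0 : ℝ) < n + 1 := by positivity
    have he : ‖x n - (1 / (μ * (n + 1))) • G n - y‖ ^ 2 = ‖x n - y‖ ^ 2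
        - 2 * ((1 / (μ * (n + 1))) * ⟪G n, x n - y⟫)
        + (1 / (μ * (n + 1))) ^ 2 * ‖G n‖ ^ 2 := by
      rw [sub_right_comm, norm_sub_sq_real, inner_smul_right, norm_smul, mul_pow,
        real_inner_comm, Real.norm_eq_abs, sq_abs]
    rw [he] at h3
    have hGn : ‖G n‖ ^ 2 ≤ L ^ 2 := pow_le_pow_left₀ (norm_nonneg _) (hG n hn') 2
    -- The weight is half the inverse step size, so the inner product gets coefficient one and
    -- cancels that of `h2`. The weight of `‖x n - y‖ ^ 2` is `μ n / 2` from `h1` plus `μ / 2` from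
    -- `h2`.
    have h4 : μ * (n + 1) / 2 * ‖x (n + 1) - y‖ ^ 2 ≤ μ * (n + 1) / 2 * ‖x n - y‖ ^ 2
        - ⟪G n, x n - y⟫ + L ^ 2 / (2 * μ) * ((n : ℝ) + 1)⁻¹ := by
      calc _ ≤ μ * (n + 1) / 2 * (‖x n - y‖ ^ 2
              - 2 * ((1 / (μ * (n + 1))) * ⟪G n, x n - y⟫)
              + (1 / (μ * (n + 1))) ^ 2 * L ^ 2) := by
            gcongr
            exact h3.trans (by gcongr)
        _ = _ := by field_simp
    push_cast
    linarith

/-- No update follows the last round; its linear term is absorbed by the remaining potential and by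
that round's own strong convexity. -/
theorem ogd_regret {f : ℕ → E → ℝ} {G x : ℕ → E} {L μ : ℝ} {T : ℕ} (hT : 0 < T)
    (hμ : 0 < μ) (hG : ∀ n < T, ‖G n‖ ≤ L) {y : E}
    (hf : ∀ n < T, f n (x n) - f n y ≤ ⟪G n, x n - y⟫ - μ / 2 * ‖x n - y‖ ^ 2)
    (hstep : ∀ n, n + 1 < T →
      ‖x (n + 1) - y‖ ^ 2 ≤ ‖x n - (1 / (μ * (n + 1))) • G n - y‖ ^ 2) :
    ∑ k ∈ Finset.range T, (f k (x k) - f k y) ≤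
      L ^ 2 / (2 * μ) * ∑ k ∈ Finset.range T, ((k : ℝ) + 1)⁻¹ := by
  obtain ⟨n, rfl⟩ := Nat.exists_eq_succ_of_ne_zero hT.ne'
  rw [Finset.sum_range_succ, Finset.sum_range_succ]
  have h1 := ogd_partial_regret hμ hG hf hstep n (by omega)
  have h2 := hf n (by omega)
  have h3 : ⟪G n, x n - y⟫ ≤ L * ‖x n - y‖ :=
    (real_inner_le_norm _ _).trans (by gcongr; exact hG n (by omega))
  have h4 := norm_mul_sub_le_sq_div (L := L) (μ := μ * (n + 1)) (d := ‖x n - y‖) (by positivity)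
  have h5 : L ^ 2 / (2 * (μ * (n + 1))) = L ^ 2 / (2 * μ) * ((n : ℝ) + 1)⁻¹ := by
    field_simp
  rw [h5] at h4
  linarith

/-- Regret of follow-the-regularized-leader on strongly convex losses. -/
theorem ftrl_regret {K : Set E} {f : ℕ → E → ℝ} {R : E → ℝ} {G x : ℕ → E} {L μ : ℝ} {T : ℕ}
    (hμ : 0 < μ) (hG : ∀ n < T, ‖G n‖ ≤ L)
    (hf : ∀ n < T, ∀ y ∈ K, f n (x n) - f n y ≤ ⟪G n, x n - y⟫ - μ / 2 * ‖x n - y‖ ^ 2)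
    (hconv : ∀ n < T, StrongConvexOn K μ (f n)) (hR : ConvexOn ℝ K R)
    (hx : ∀ n < T, x n ∈ K)
    (hmin : ∀ n < T, ∀ z ∈ K,
      ∑ k ∈ Finset.range n, f k (x n) + R (x n) ≤ ∑ k ∈ Finset.range n, f k z + R z)
    (n : ℕ) (hn : n ≤ T) (h0 : 0 < T) (y : E) (hy : y ∈ K) :
    ∑ k ∈ Finset.range n, f k (x k) + R (x 0) ≤
      ∑ k ∈ Finset.range n, f k y + R y +
        L ^ 2 / (2 * μ) * ∑ k ∈ Finset.range n, ((k : ℝ) + 1)⁻¹ := by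
  induction n generalizing y with
  | zero => simpa using hmin 0 h0 y hy
  | succ n ih =>
    have hn' : n < T := by omega
    -- The comparator for the earlier rounds is the leader `x n` itself. Those rounds give `μ n` of
    -- quadratic growth away from it, and round `n` adds another `μ`.
    have h1 := ih hn'.le (x n) (hx n hn')
    have h2 := quadratic_growth_of_isMinOn hR.1 (F := fun z => ∑ k ∈ Finset.range n, f k z + R z)
      (m := μ * n) (hx n hn') hy (by
        intro a b ha hb hab
        have hRab := hR.2 (hx n hn') hy ha hb hab
        have hsum : ∑ k ∈ Finset.range n, f k (a • x n + b • y) ≤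
            ∑ k ∈ Finset.range n, (a * f k (x n) + b * f k y -
              a * b * (μ / 2 * ‖x n - y‖ ^ 2)) :=
          Finset.sum_le_sum fun k hk =>
            (hconv k (by have := Finset.mem_range.1 hk; omega)).2 (hx n hn') hy ha hb hab
        rw [Finset.sum_sub_distrib, Finset.sum_add_distrib, ← Finset.mul_sum, ← Finset.mul_sum,
          Finset.sum_const, Finset.card_range, nsmul_eq_mul] at hsum
        simp only [smul_eq_mul] at hRab
        linarith) (hmin n hn')
    have h3 : ⟪G n, x n - y⟫ ≤ L * ‖x n - y‖ :=
      (real_inner_le_norm _ _).trans (by gcongr; exact hG n hn')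
    have h4 := norm_mul_sub_le_sq_div (L := L) (μ := μ * (n + 1)) (d := ‖x n - y‖)
      (by positivity)
    have h5 : L ^ 2 / (2 * (μ * (n + 1))) = L ^ 2 / (2 * μ) * ((n : ℝ) + 1)⁻¹ := by
      field_simp
    rw [h5] at h4
    have h6 := hf n hn' y hy
    rw [Finset.sum_range_succ, Finset.sum_range_succ, Finset.sum_range_succ]
    linarith

/-- The vectors `u - v` and `y - v` form an obtuse or right angle at the projection `v`. -/
theorem norm_sub_le_of_nearest {K : Set E} (hK : Convex ℝ K) {u v y : E} (hv : v ∈ K)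
    (hy : y ∈ K) (h : ∀ w ∈ K, ‖v - u‖ ≤ ‖w - u‖) : ‖v - y‖ ^ 2 ≤ ‖u - y‖ ^ 2 := by
  have hinf : ‖u - v‖ = ⨅ w : K, ‖u - w‖ := by
    have : Nonempty K := ⟨⟨v, hv⟩⟩
    refine le_antisymm (le_ciInf fun w => ?_) ?_
    · rw [norm_sub_rev u v, norm_sub_rev u w]; exact h w w.2
    · exact ciInf_le ⟨0, by rintro _ ⟨w, rfl⟩; positivity⟩ (⟨v, hv⟩ : K)
  have h1 := (norm_eq_iInf_iff_real_inner_le_zero hK hv).1 hinf y hy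
  have h2 : u - y = (u - v) - (y - v) := by abel
  rw [h2, norm_sub_sq_real (u - v), norm_sub_rev v y]
  nlinarith [sq_nonneg ‖u - v‖]

end Regret

theorem sum_range_inv_le_one_add_log (T : ℕ) :
    ∑ k ∈ Finset.range T, ((k : ℝ) + 1)⁻¹ ≤ Real.log T + 1 := by
  have h := harmonic_le_one_add_log T
  simp only [harmonic] at h
  push_cast at h
  linarith

/-! ### Regret of either meta-learner -/

section

open scoped RealInnerProductSpace

variable {E : Type*} [NormedAddCommGroup E] [InnerProductSpace ℝ E] [CompleteSpace E] {T : ℕ}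

/-- Extension of a finite sequence to the natural numbers. -/
def extendFin {β : Type*} (hT : 0 < T) (f : Fin T → β) (n : ℕ) : β :=
  if h : n < T then f ⟨n, h⟩ else f ⟨0, hT⟩

theorem extendFin_coe {β : Type*} (hT : 0 < T) (f : Fin T → β) (t : Fin T) :
    extendFin hT f t = f t := by
  simp [extendFin]

/-- Regret of either meta-learner against a fixed decision. -/
theorem meta_regret (hT : 0 < T) {K : Set E} {f : Fin T → E → ℝ} {L μ : ℝ} (hμ : 0 < μ)
    (hdiff : ∀ t, ∀ z ∈ K, DifferentiableAt ℝ (f t) z)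
    (hgrad : ∀ t, ∀ z ∈ K, ‖gradient (f t) z‖ ≤ L)
    (hconv : ∀ t, StrongConvexOn K μ (f t)) {x : Fin T → E}
    (hx : IsOGD K f μ x ∨ ∃ R : E → ℝ, ConvexOn ℝ K R ∧
      (∀ y ∈ K, ∀ z ∈ K, R y - R z ≤ L ^ 2 * (Real.log T + 1) / (2 * μ)) ∧ IsFTRL K f R x)
    {y : E} (hy : y ∈ K) :
    ∑ t, f t (x t) ≤ ∑ t, f t y + L ^ 2 * (Real.log T + 1) / μ := by
  have hxK : ∀ t, x t ∈ K := by
    rcases hx with h | ⟨R, -, -, h⟩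
    exacts [h.1, fun t => (h t).1]
  have hfirst : ∀ t, ∀ z ∈ K, f t (x t) - f t z ≤
      ⟪gradient (f t) (x t), x t - z⟫ - μ / 2 * ‖x t - z‖ ^ 2 := by
    intro t z hz
    have h := (hconv t).inner_gradient_add_le (hxK t) hz (hdiff t _ (hxK t))
    have e : ⟪gradient (f t) (x t), z - x t⟫ = -⟪gradient (f t) (x t), x t - z⟫ := by
      rw [← inner_neg_right, neg_sub]
    rw [e, norm_sub_rev] at h
    linarith
  have hlog : L ^ 2 / (2 * μ) * ∑ k ∈ Finset.range T, ((k : ℝ) + 1)⁻¹ ≤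
      L ^ 2 / (2 * μ) * (Real.log T + 1) := by
    gcongr
    exact sum_range_inv_le_one_add_log T
  have hpos : 0 ≤ L ^ 2 / (2 * μ) * (Real.log T + 1) :=
    mul_nonneg (by positivity) (add_nonneg (Real.log_natCast_nonneg T) zero_le_one)
  -- Half of the budget pays for the regret; the other half pays for the oscillation of `R` and is
  -- spare for gradient descent.
  have hhalf : L ^ 2 * (Real.log T + 1) / μ =
      L ^ 2 / (2 * μ) * (Real.log T + 1) + L ^ 2 / (2 * μ) * (Real.log T + 1) := by
    field_simp; ring
  set f' := extendFin hT f with hf'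
  set x' := extendFin hT x with hx'
  set G' := extendFin hT (fun t => gradient (f t) (x t)) with hG'
  have ef : ∀ t : Fin T, f' t = f t := extendFin_coe hT f
  have ex : ∀ t : Fin T, x' t = x t := extendFin_coe hT x
  have eG : ∀ t : Fin T, G' t = gradient (f t) (x t) := extendFin_coe hT _
  have hG'L : ∀ n < T, ‖G' n‖ ≤ L := by
    intro n hn
    rw [eG ⟨n, hn⟩]
    exact hgrad _ _ (hxK _)
  have hfirst' : ∀ n < T, ∀ z ∈ K, f' n (x' n) - f' n z ≤
      ⟪G' n, x' n - z⟫ - μ / 2 * ‖x' n - z‖ ^ 2 := by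
    intro n hn z hz
    rw [eG ⟨n, hn⟩, ex ⟨n, hn⟩, ef ⟨n, hn⟩]
    exact hfirst _ z hz
  have es1 : ∑ t, f t (x t) = ∑ k ∈ Finset.range T, f' k (x' k) := by
    rw [← Fin.sum_univ_eq_sum_range (fun k => f' k (x' k))]
    exact Finset.sum_congr rfl fun t _ => by rw [ef, ex]
  have es2 : ∑ t, f t y = ∑ k ∈ Finset.range T, f' k y := by
    rw [← Fin.sum_univ_eq_sum_range (fun k => f' k y)]
    exact Finset.sum_congr rfl fun t _ => by rw [ef]
  rw [es1, es2]
  rcases hx with h | ⟨R, hR, hosc, h⟩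
  · have h1 := ogd_regret hT hμ hG'L (fun n hn => hfirst' n hn y hy) (by
      intro n hn
      have hn' : n < T := by omega
      rw [eG ⟨n, hn'⟩, ex ⟨n, hn'⟩, ex ⟨n + 1, hn⟩]
      exact norm_sub_le_of_nearest (hconv ⟨n, hn'⟩).1 (hxK _) hy
        (h.2 ⟨n, hn'⟩ ⟨n + 1, hn⟩ rfl))
    rw [Finset.sum_sub_distrib] at h1
    linarith
  · have hfilter : ∀ (t : Fin T) (z : E),
        ∑ s ∈ Finset.univ.filter (fun s => s < t), f s z = ∑ k ∈ Finset.range t, f' k z := by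
      intro t z
      rw [Finset.sum_filter]
      have e1 : ∑ s : Fin T, (if s < t then f s z else 0) =
          ∑ s : Fin T, (fun k : ℕ => if k < t then f' k z else 0) s :=
        Finset.sum_congr rfl fun s _ => by simp only [ef, Fin.lt_def]
      rw [e1, Fin.sum_univ_eq_sum_range (fun k : ℕ => if k < t then f' k z else 0),
        ← Finset.sum_filter]
      congr 1
      ext k
      simp only [Finset.mem_filter, Finset.mem_range]
      have := t.2
      omega
    have h1 := ftrl_regret hμ hG'L hfirst' (fun n hn => by
        rw [ef ⟨n, hn⟩]; exact hconv _) hR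
      (fun n hn => by rw [ex ⟨n, hn⟩]; exact hxK _)
      (fun n hn z hz => by
        have hm := isMinOn_iff.1 (h ⟨n, hn⟩).2 z hz
        beta_reduce at hm
        rw [hfilter, hfilter] at hm
        rw [ex ⟨n, hn⟩]
        exact hm) T le_rfl hT y hy
    have h2 := hosc y hy (x' 0) (by rw [ex ⟨0, hT⟩]; exact hxK _)
    have e : L ^ 2 * (Real.log T + 1) / (2 * μ) = L ^ 2 / (2 * μ) * (Real.log T + 1) := by ring
    linarith

end
-- Occupancy measures, Bellman equation, performance difference
namespace CMDP

variable {S A : Type*} [Fintype S] [Fintype A] {p : ℕ}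

theorem pairLaw_nonneg (C : CMDP S A p) {π w : S → A → ℝ} (hπ : ∀ s a, 0 ≤ π s a)
    (hw : ∀ s a, 0 ≤ w s a) (m : ℕ) (s : S) (a : A) : 0 ≤ C.pairLaw π w m s a := by
  induction m generalizing s a with
  | zero => exact hw s a
  | succ m ih =>
    exact mul_nonneg (Finset.sum_nonneg fun s' _ => Finset.sum_nonneg fun a' _ =>
      mul_nonneg (ih s' a') (C.trans_nonneg _ _ _)) (hπ s a)

theorem sum_pairLaw (C : CMDP S A p) {π w : S → A → ℝ} (hπ : ∀ s, ∑ a, π s a = 1) (m : ℕ) :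
    ∑ s, ∑ a, C.pairLaw π w m s a = ∑ s, ∑ a, w s a := by
  induction m with
  | zero => rfl
  | succ m ih =>
    rw [← ih]
    simp only [pairLaw]
    simp_rw [← Finset.mul_sum, hπ, mul_one]
    rw [Finset.sum_comm]
    refine Finset.sum_congr rfl fun s _ => ?_
    rw [Finset.sum_comm]
    refine Finset.sum_congr rfl fun a _ => ?_
    rw [← Finset.mul_sum, C.trans_sum, mul_one]

/-- Recursion at the first transition instead of the last, as the Bellman equation requires. -/
theorem pairLaw_succ' (C : CMDP S A p) (π w : S → A → ℝ) (m : ℕ) :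
    C.pairLaw π w (m + 1) = C.pairLaw π (C.pairLaw π w 1) m := by
  induction m with
  | zero => rfl
  | succ m ih =>
    funext s a
    rw [pairLaw, ih]
    rfl

theorem pairLaw_sum_smul (C : CMDP S A p) {ι : Type*} (I : Finset ι) (k : ι → ℝ)
    (π : S → A → ℝ) (w : ι → S → A → ℝ) (m : ℕ) (s : S) (a : A) :
    C.pairLaw π (fun s a => ∑ i ∈ I, k i * w i s a) m s a =
      ∑ i ∈ I, k i * C.pairLaw π (w i) m s a := by
  induction m generalizing s a with
  | zero => rfl
  | succ m ih =>
    have h : ∑ s', ∑ a', (∑ i ∈ I, k i * C.pairLaw π (w i) m s' a') * C.trans s' a' s =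
        ∑ i ∈ I, k i * ∑ s', ∑ a', C.pairLaw π (w i) m s' a' * C.trans s' a' s := by
      simp_rw [Finset.sum_mul, Finset.mul_sum, mul_assoc]
      exact (Finset.sum_congr rfl fun s _ => Finset.sum_comm).trans Finset.sum_comm
    simp only [pairLaw, ih]
    rw [h, Finset.sum_mul]
    exact Finset.sum_congr rfl fun i _ => by ring

theorem pairLaw_le (C : CMDP S A p) {π w : S → A → ℝ} (hπ : π ∈ policySet S A 0)
    (hw : ∀ s a, 0 ≤ w s a) (m : ℕ) (s : S) (a : A) :
    C.pairLaw π w m s a ≤ ∑ s, ∑ a, w s a := by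
  have h := C.pairLaw_nonneg (fun s a => (hπ s).1 a) hw m
  rw [← C.sum_pairLaw (fun s => (hπ s).2) m]
  exact (Finset.single_le_sum (f := fun a => C.pairLaw π w m s a) (fun a _ => h s a)
      (Finset.mem_univ a)).trans
    (Finset.single_le_sum (f := fun s => ∑ a, C.pairLaw π w m s a)
      (fun s _ => Finset.sum_nonneg fun a _ => h s a) (Finset.mem_univ s))

/-- Discounted occupancy measure of the state-action pairs, when the first pair has law `w`. -/
noncomputable def occupancy (γ : ℝ) (C : CMDP S A p) (π w : S → A → ℝ) (s : S) (a : A) : ℝ :=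
  ∑' m : ℕ, γ ^ m * C.pairLaw π w m s a

section Discounted

variable {γ : ℝ} (C : CMDP S A p) {π : S → A → ℝ}

theorem hasSum_occupancy (hγ₀ : 0 ≤ γ) (hγ₁ : γ < 1) (hπ : π ∈ policySet S A 0)
    {w : S → A → ℝ} (hw : ∀ s a, 0 ≤ w s a) (s : S) (a : A) :
    HasSum (fun m : ℕ => γ ^ m * C.pairLaw π w m s a) (occupancy γ C π w s a) :=
  (Summable.of_nonneg_of_le
    (fun m => mul_nonneg (pow_nonneg hγ₀ m) (C.pairLaw_nonneg (fun s a => (hπ s).1 a) hw m s a))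
    (fun m => mul_le_mul_of_nonneg_left (C.pairLaw_le hπ hw m s a) (pow_nonneg hγ₀ m))
    ((summable_geometric_of_lt_one hγ₀ hγ₁).mul_right _)).hasSum

theorem occupancy_nonneg (hγ₀ : 0 ≤ γ) (hπ : π ∈ policySet S A 0)
    {w : S → A → ℝ} (hw : ∀ s a, 0 ≤ w s a) (s : S) (a : A) : 0 ≤ occupancy γ C π w s a :=
  tsum_nonneg fun m => mul_nonneg (pow_nonneg hγ₀ m)
    (C.pairLaw_nonneg (fun s a => (hπ s).1 a) hw m s a)

theorem hasSum_sum_occupancy (hγ₀ : 0 ≤ γ) (hγ₁ : γ < 1) (hπ : π ∈ policySet S A 0)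
    {w : S → A → ℝ} (hw : ∀ s a, 0 ≤ w s a) (c : S → A → ℝ) :
    HasSum (fun m : ℕ => γ ^ m * ∑ s, ∑ a, C.pairLaw π w m s a * c s a)
      (∑ s, ∑ a, occupancy γ C π w s a * c s a) := by
  have h := hasSum_sum (s := Finset.univ) fun s _ => hasSum_sum (s := Finset.univ) fun a _ =>
    (C.hasSum_occupancy hγ₀ hγ₁ hπ hw s a).mul_right (c s a)
  simpa only [Finset.mul_sum, mul_assoc] using h

theorem discountedSum_eq (hγ₀ : 0 ≤ γ) (hγ₁ : γ < 1) (hπ : π ∈ policySet S A 0)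
    {w : S → A → ℝ} (hw : ∀ s a, 0 ≤ w s a) (i : Fin (p + 1)) :
    discountedSum γ C i π w = ∑ s, ∑ a, occupancy γ C π w s a * C.signal i s a :=
  (C.hasSum_sum_occupancy hγ₀ hγ₁ hπ hw _).tsum_eq

theorem sum_occupancy (hγ₀ : 0 ≤ γ) (hγ₁ : γ < 1) (hπ : π ∈ policySet S A 0)
    {w : S → A → ℝ} (hw : ∀ s a, 0 ≤ w s a) :
    ∑ s, ∑ a, occupancy γ C π w s a = (∑ s, ∑ a, w s a) / (1 - γ) := by
  have h := C.hasSum_sum_occupancy hγ₀ hγ₁ hπ hw fun _ _ => 1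
  simp only [mul_one, C.sum_pairLaw (fun s => (hπ s).2)] at h
  have h' := (hasSum_geometric_of_lt_one hγ₀ hγ₁).mul_right (∑ s, ∑ a, w s a)
  rw [h.unique h', div_eq_inv_mul]

theorem occupancy_shift (hγ₀ : 0 ≤ γ) (hγ₁ : γ < 1) (hπ : π ∈ policySet S A 0)
    {w : S → A → ℝ} (hw : ∀ s a, 0 ≤ w s a) (s : S) (a : A) :
    occupancy γ C π w s a = w s a + γ * occupancy γ C π (C.pairLaw π w 1) s a := by
  have h := (C.hasSum_occupancy hγ₀ hγ₁ hπ hw s a).summable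
  rw [occupancy, h.tsum_eq_zero_add, occupancy, ← tsum_mul_left]
  congr 1
  · simp [pairLaw]
  · exact tsum_congr fun m => by rw [C.pairLaw_succ', pow_succ', mul_assoc]

/-- Here the last transition is split off, in contrast to `occupancy_shift`. If `w` is itself a
state law times `π`, the occupancy thereby factors as a state weight times `π`. -/
theorem occupancy_flow (hγ₀ : 0 ≤ γ) (hγ₁ : γ < 1) (hπ : π ∈ policySet S A 0)
    {w : S → A → ℝ} (hw : ∀ s a, 0 ≤ w s a) (s' : S) (a' : A) :
    occupancy γ C π w s' a' = w s' a' +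
      γ * ((∑ s, ∑ a, occupancy γ C π w s a * C.trans s a s') * π s' a') := by
  have h := (C.hasSum_occupancy hγ₀ hγ₁ hπ hw s' a').summable
  have h2 := (((C.hasSum_sum_occupancy hγ₀ hγ₁ hπ hw fun s a => C.trans s a s').mul_right
    (π s' a')).mul_left γ).tsum_eq
  rw [occupancy, h.tsum_eq_zero_add, ← h2]
  simp only [pow_zero, one_mul, pow_succ', mul_assoc]
  rfl

theorem occupancy_sum_smul (hγ₀ : 0 ≤ γ) (hγ₁ : γ < 1) (hπ : π ∈ policySet S A 0)
    {ι : Type*} (I : Finset ι) (k : ι → ℝ) (w : ι → S → A → ℝ)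
    (hw : ∀ i s a, 0 ≤ w i s a) (s : S) (a : A) :
    occupancy γ C π (fun s a => ∑ i ∈ I, k i * w i s a) s a =
      ∑ i ∈ I, k i * occupancy γ C π (w i) s a := by
  have h := hasSum_sum (s := I) fun i _ =>
    (C.hasSum_occupancy hγ₀ hγ₁ hπ (hw i) s a).mul_left (k i)
  rw [← h.tsum_eq, occupancy]
  refine tsum_congr fun m => ?_
  rw [C.pairLaw_sum_smul, Finset.mul_sum]
  exact Finset.sum_congr rfl fun i _ => by ring

theorem discountedSum_sum_smul (hγ₀ : 0 ≤ γ) (hγ₁ : γ < 1) (hπ : π ∈ policySet S A 0)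
    {ι : Type*} (I : Finset ι) (k : ι → ℝ) (w : ι → S → A → ℝ) (hk : ∀ i, 0 ≤ k i)
    (hw : ∀ i s a, 0 ≤ w i s a) (i : Fin (p + 1)) :
    discountedSum γ C i π (fun s a => ∑ i ∈ I, k i * w i s a) =
      ∑ j ∈ I, k j * discountedSum γ C i π (w j) := by
  rw [C.discountedSum_eq hγ₀ hγ₁ hπ fun s a =>
    Finset.sum_nonneg fun i _ => mul_nonneg (hk i) (hw i s a)]
  simp_rw [C.discountedSum_eq hγ₀ hγ₁ hπ (hw _), C.occupancy_sum_smul hγ₀ hγ₁ hπ I k w hw,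
    Finset.sum_mul, Finset.mul_sum, mul_assoc]
  exact (Finset.sum_congr rfl fun s _ => Finset.sum_comm).trans Finset.sum_comm

variable [DecidableEq S]

omit [Fintype S] in
theorem startAt_nonneg (hπ : π ∈ policySet S A 0) (s₀ s : S) (a : A) :
    0 ≤ startAt π s₀ s a := by
  rw [startAt]; split_ifs
  exacts [(hπ s).1 a, le_rfl]

theorem visitation_eq (hγ₀ : 0 ≤ γ) (hγ₁ : γ < 1) (hπ : π ∈ policySet S A 0) (s : S) :
    visitation γ C π s = (1 - γ) *
      ∑ a, occupancy γ C π (fun s a => C.init s * π s a) s a := by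
  have h0 : (fun s a => C.init s * π s a) =
      fun s a => ∑ s₀, C.init s₀ * startAt π s₀ s a := by
    funext s a
    simp [startAt]
  have h1 : ∀ s₀, ∑' m : ℕ, γ ^ m * ∑ a, C.pairLaw π (startAt π s₀) m s a =
      ∑ a, occupancy γ C π (startAt π s₀) s a := by
    intro s₀
    rw [← (hasSum_sum (s := Finset.univ) fun a _ =>
      C.hasSum_occupancy hγ₀ hγ₁ hπ (startAt_nonneg hπ s₀) s a).tsum_eq]
    simp_rw [Finset.mul_sum]
  rw [visitation, h0]
  simp_rw [h1, C.occupancy_sum_smul hγ₀ hγ₁ hπ Finset.univ C.init (startAt π)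
    (startAt_nonneg hπ)]
  rw [Finset.sum_comm, Finset.mul_sum]
  refine Finset.sum_congr rfl fun s₀ _ => ?_
  rw [← Finset.mul_sum]
  ring

theorem visitation_nonneg (hγ₀ : 0 ≤ γ) (hγ₁ : γ < 1) (hπ : π ∈ policySet S A 0) (s : S) :
    0 ≤ visitation γ C π s := by
  rw [C.visitation_eq hγ₀ hγ₁ hπ]
  exact mul_nonneg (by linarith) (Finset.sum_nonneg fun a _ => C.occupancy_nonneg hγ₀ hπ
    (fun s a => mul_nonneg (C.init_nonneg s) ((hπ s).1 a)) s a)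

theorem sum_visitation (hγ₀ : 0 ≤ γ) (hγ₁ : γ < 1) (hπ : π ∈ policySet S A 0) :
    ∑ s, visitation γ C π s = 1 := by
  simp_rw [C.visitation_eq hγ₀ hγ₁ hπ]
  rw [← Finset.mul_sum, C.sum_occupancy hγ₀ hγ₁ hπ
    (fun s a => mul_nonneg (C.init_nonneg s) ((hπ s).1 a))]
  simp_rw [← Finset.mul_sum, (hπ _).2, mul_one, C.init_sum]
  have : 1 - γ ≠ 0 := by linarith
  field_simp

variable [DecidableEq A]

/-- The law `w` is a mixture of point masses, and the discounted sum is linear in the starting law.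
-/
theorem discountedSum_eq_sum_actionValue (hγ₀ : 0 ≤ γ) (hγ₁ : γ < 1) (hπ : π ∈ policySet S A 0)
    {w : S → A → ℝ} (hw : ∀ s a, 0 ≤ w s a) (i : Fin (p + 1)) :
    discountedSum γ C i π w = ∑ s, ∑ a, w s a * actionValue γ C i π s a := by
  have hw' : w = fun s a => ∑ q ∈ (Finset.univ : Finset (S × A)), w q.1 q.2 *
      (if s = q.1 ∧ a = q.2 then 1 else 0) := by
    funext s a
    rw [Finset.sum_eq_single (s, a)]
    · simp
    · rintro ⟨s', a'⟩ - h
      rw [if_neg, mul_zero]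
      rintro ⟨rfl, rfl⟩
      exact h rfl
    · simp
  conv_lhs => rw [hw']
  rw [C.discountedSum_sum_smul hγ₀ hγ₁ hπ Finset.univ (fun q : S × A => w q.1 q.2)
    (fun q s a => if s = q.1 ∧ a = q.2 then 1 else 0) (fun q => hw _ _)
    (fun q s a => by split_ifs <;> norm_num), Fintype.sum_prod_type]
  rfl

theorem actionValue_bellman (hγ₀ : 0 ≤ γ) (hγ₁ : γ < 1) (hπ : π ∈ policySet S A 0)
    (i : Fin (p + 1)) (s : S) (a : A) :
    actionValue γ C i π s a = C.signal i s a +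
      γ * ∑ s', C.trans s a s' * ∑ a', π s' a' * actionValue γ C i π s' a' := by
  set δ : S → A → ℝ := fun s' a' => if s' = s ∧ a' = a then 1 else 0 with hδ
  have hδ0 : ∀ s a, 0 ≤ δ s a := fun s a => by simp only [hδ]; split_ifs <;> norm_num
  have hδs : ∀ g : S → A → ℝ, ∑ s', ∑ a', δ s' a' * g s' a' = g s a := by
    intro g
    rw [Finset.sum_eq_single s, Finset.sum_eq_single a]
    · simp [hδ]
    · intro b _ hb; simp [hδ, hb]
    · simp
    · intro b _ hb; simp [hδ, hb]
    · simp
  have h1 : C.pairLaw π δ 1 = fun s' a' => C.trans s a s' * π s' a' := by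
    funext s' a'
    rw [pairLaw]
    change (∑ s, ∑ a, δ s a * C.trans s a s') * π s' a' = _
    rw [hδs fun s a => C.trans s a s']
  have h2 : actionValue γ C i π s a = ∑ s', ∑ a', δ s' a' * C.signal i s' a' +
      γ * discountedSum γ C i π (C.pairLaw π δ 1) := by
    change discountedSum γ C i π δ = _
    rw [C.discountedSum_eq hγ₀ hγ₁ hπ hδ0, C.discountedSum_eq hγ₀ hγ₁ hπ
      (C.pairLaw_nonneg (fun s a => (hπ s).1 a) hδ0 1)]
    simp_rw [C.occupancy_shift hγ₀ hγ₁ hπ hδ0, add_mul, Finset.sum_add_distrib, Finset.mul_sum,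
      mul_assoc]
  rw [h2, hδs, C.discountedSum_eq_sum_actionValue hγ₀ hγ₁ hπ
      (C.pairLaw_nonneg (fun s a => (hπ s).1 a) hδ0 1), h1]
  simp_rw [Finset.mul_sum, mul_assoc]

/-- The occupancy has mass `1 / (1 - γ)` and signals lie in `[0, 1]`. This range enters Hoeffding's
lemma. -/
theorem actionValue_mem_Icc (hγ₀ : 0 ≤ γ) (hγ₁ : γ < 1) (hπ : π ∈ policySet S A 0)
    (i : Fin (p + 1)) (s : S) (a : A) :
    actionValue γ C i π s a ∈ Set.Icc 0 (1 / (1 - γ)) := by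
  set δ : S → A → ℝ := fun s' a' => if s' = s ∧ a' = a then 1 else 0 with hδ
  have hδ0 : ∀ s a, 0 ≤ δ s a := fun s a => by simp only [hδ]; split_ifs <;> norm_num
  have hδs : ∑ s', ∑ a', δ s' a' = 1 := by
    rw [Finset.sum_eq_single s, Finset.sum_eq_single a]
    · simp [hδ]
    · intro b _ hb; simp [hδ, hb]
    · simp
    · intro b _ hb; simp [hδ, hb]
    · simp
  have hocc := C.occupancy_nonneg hγ₀ hπ hδ0
  have hsum := C.sum_occupancy hγ₀ hγ₁ hπ hδ0
  rw [hδs] at hsum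
  rw [← hsum]
  change discountedSum γ C i π δ ∈ _
  rw [C.discountedSum_eq hγ₀ hγ₁ hπ hδ0]
  exact ⟨Finset.sum_nonneg fun s _ => Finset.sum_nonneg fun a _ =>
      mul_nonneg (hocc s a) (C.signal_nonneg i s a),
    Finset.sum_le_sum fun s _ => Finset.sum_le_sum fun a _ =>
      mul_le_of_le_one_right (hocc s a) (C.signal_le_one i s a)⟩

theorem stateValue_eq (hγ₀ : 0 ≤ γ) (hγ₁ : γ < 1) (hπ : π ∈ policySet S A 0)
    (i : Fin (p + 1)) (s : S) :
    stateValue γ C i π s = ∑ a, π s a * actionValue γ C i π s a := by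
  rw [stateValue, C.discountedSum_eq_sum_actionValue hγ₀ hγ₁ hπ (startAt_nonneg hπ s),
    Finset.sum_eq_single s]
  · simp [startAt]
  · intro b _ hb; simp [startAt, hb]
  · simp

theorem total_eq (hγ₀ : 0 ≤ γ) (hγ₁ : γ < 1) (hπ : π ∈ policySet S A 0) (i : Fin (p + 1)) :
    total γ C i π = discountedSum γ C i π (fun s a => C.init s * π s a) := by
  rw [C.discountedSum_eq_sum_actionValue hγ₀ hγ₁ hπ
    fun s a => mul_nonneg (C.init_nonneg s) ((hπ s).1 a), total]
  simp_rw [C.stateValue_eq hγ₀ hγ₁ hπ, Finset.mul_sum, mul_assoc]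

/-- Performance difference lemma. -/
theorem performance_difference (hγ₀ : 0 ≤ γ) (hγ₁ : γ < 1) {π' : S → A → ℝ}
    (hπ : π ∈ policySet S A 0) (hπ' : π' ∈ policySet S A 0) (i : Fin (p + 1)) :
    ∑ s, visitation γ C π' s * ∑ a, (π' s a - π s a) * actionValue γ C i π s a =
      (1 - γ) * (total γ C i π' - total γ C i π) := by
  set w : S → A → ℝ := fun s a => C.init s * π' s a with hw
  have hw0 : ∀ s a, 0 ≤ w s a := fun s a => mul_nonneg (C.init_nonneg s) ((hπ' s).1 a)
  set O := occupancy γ C π' w with hO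
  set Q := actionValue γ C i π with hQ
  set V : S → ℝ := fun s => ∑ a, π s a * Q s a with hV
  set N : S → ℝ := fun s => C.init s + γ * ∑ s', ∑ a', O s' a' * C.trans s' a' s with hN
  have hON : ∀ s a, O s a = N s * π' s a := by
    intro s a
    rw [hO, C.occupancy_flow hγ₀ hγ₁ hπ' hw0]
    simp only [hN, hw, hO]
    ring
  have hvis : ∀ s, visitation γ C π' s = (1 - γ) * N s := by
    intro s
    rw [C.visitation_eq hγ₀ hγ₁ hπ']
    congr 1
    change ∑ a, O s a = _
    simp_rw [hON, ← Finset.mul_sum, (hπ' s).2, mul_one]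
  have hJ' : total γ C i π' = ∑ s, ∑ a, O s a * C.signal i s a := by
    rw [C.total_eq hγ₀ hγ₁ hπ', C.discountedSum_eq hγ₀ hγ₁ hπ' hw0]
  have hJ : total γ C i π = ∑ s, C.init s * V s := by
    rw [total]
    simp_rw [C.stateValue_eq hγ₀ hγ₁ hπ]
    rfl
  have hB : ∀ s a, Q s a = C.signal i s a + γ * ∑ s', C.trans s a s' * V s' :=
    C.actionValue_bellman hγ₀ hγ₁ hπ i
  -- Insert the Bellman equation for `π` under the occupancy of `π'`. The flow term on the right
  -- reappears in `hNV` and cancels.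
  have hOQ : ∑ s, ∑ a, O s a * Q s a = total γ C i π' +
      ∑ s, (γ * ∑ s', ∑ a', O s' a' * C.trans s' a' s) * V s := by
    rw [hJ']
    have e : ∀ s a, O s a * Q s a = O s a * C.signal i s a +
        ∑ s', γ * (O s a * C.trans s a s' * V s') := by
      intro s a
      rw [hB, mul_add, Finset.mul_sum, Finset.mul_sum]
      congr 1
      exact Finset.sum_congr rfl fun s' _ => by ring
    simp_rw [e, Finset.sum_add_distrib]
    congr 1
    simp_rw [Finset.mul_sum, Finset.sum_mul, mul_assoc]
    exact (Finset.sum_congr rfl fun s _ => Finset.sum_comm).trans Finset.sum_comm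
  have hNV : ∑ s, N s * V s = total γ C i π +
      ∑ s, (γ * ∑ s', ∑ a', O s' a' * C.trans s' a' s) * V s := by
    rw [hJ, ← Finset.sum_add_distrib]
    exact Finset.sum_congr rfl fun s _ => by simp only [hN]; ring
  have hL : ∑ s, visitation γ C π' s * ∑ a, (π' s a - π s a) * Q s a =
      (1 - γ) * (∑ s, ∑ a, O s a * Q s a - ∑ s, N s * V s) := by
    rw [← Finset.sum_sub_distrib, Finset.mul_sum]
    refine Finset.sum_congr rfl fun s _ => ?_
    simp_rw [hvis, hON, sub_mul, Finset.sum_sub_distrib, mul_assoc, ← Finset.mul_sum, hV]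
    ring
  rw [hL, hOQ, hNV]
  ring

end Discounted

end CMDP
-- Hoeffding's lemma and multiplicative weights
open MeasureTheory in
/-- Hoeffding's lemma for a random variable on a finite probability space. -/
theorem sum_mul_exp_le_of_mem_Icc {A : Type*} [Fintype A] {q X : A → ℝ} {B : ℝ}
    (hq : ∀ a, 0 ≤ q a) (hq1 : ∑ a, q a = 1) (hX : ∀ a, X a ∈ Set.Icc 0 B) (t : ℝ) :
    ∑ a, q a * Real.exp (t * X a) ≤ Real.exp (t * ∑ a, q a * X a + t ^ 2 * B ^ 2 / 8) := by
  let _ : MeasurableSpace A := ⊤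
  set ν : Measure A := ∑ a, ENNReal.ofReal (q a) • Measure.dirac a with hν
  have hint : ∀ f : A → ℝ, ∫ a, f a ∂ν = ∑ a, q a * f a := by
    intro f
    rw [hν, integral_finsetSum_measure fun a _ =>
      (integrable_dirac (by simp)).smul_measure ENNReal.ofReal_ne_top]
    refine Finset.sum_congr rfl fun a _ => ?_
    rw [integral_smul_measure, integral_dirac, ENNReal.toReal_ofReal (hq a), smul_eq_mul]
  have hprob : IsProbabilityMeasure ν := ⟨by
    rw [hν, Measure.finsetSum_apply]
    simp only [Measure.smul_apply, measure_univ, smul_eq_mul, mul_one]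
    rw [← ENNReal.ofReal_sum_of_nonneg fun a _ => hq a, hq1, ENNReal.ofReal_one]⟩
  have h := (ProbabilityTheory.hasSubgaussianMGF_of_mem_Icc (μ := ν) (X := X) (a := 0) (b := B)
    (measurable_from_top.aemeasurable) (Filter.Eventually.of_forall hX)).mgf_le t
  rw [ProbabilityTheory.mgf, hint, hint] at h
  have e : ∀ a, q a * Real.exp (t * X a) = Real.exp (t * ∑ a, q a * X a) *
      (q a * Real.exp (t * (X a - ∑ a, q a * X a))) := by
    intro a
    rw [mul_left_comm, ← Real.exp_add]
    ring_nf
  simp_rw [e]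
  rw [← Finset.mul_sum, Real.exp_add]
  refine mul_le_mul_of_nonneg_left (h.trans_eq ?_) (Real.exp_pos _).le
  -- The sub-Gaussian parameter is `(B / 2) ^ 2`, and the exponent is half of it times `t ^ 2`.
  congr 1
  simp only [sub_zero, NNReal.coe_pow, NNReal.coe_div, coe_nnnorm, NNReal.coe_ofNat, div_pow,
    Real.norm_eq_abs, sq_abs]
  ring

section Softmax

variable {S A : Type*} [Fintype A]

theorem sum_exp_pos [Nonempty A] (f : A → ℝ) : 0 < ∑ a, Real.exp (f a) :=
  Finset.sum_pos (fun _ _ => Real.exp_pos _) Finset.univ_nonempty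

theorem softmaxPolicy_pos [Nonempty A] (θ : S → A → ℝ) (s : S) (a : A) :
    0 < softmaxPolicy θ s a :=
  div_pos (Real.exp_pos _) (sum_exp_pos _)

theorem sum_softmaxPolicy [Nonempty A] (θ : S → A → ℝ) (s : S) :
    ∑ a, softmaxPolicy θ s a = 1 := by
  simp only [softmaxPolicy]
  rw [← Finset.sum_div, div_self (sum_exp_pos _).ne']

theorem softmaxPolicy_mem_policySet [Nonempty A] (θ : S → A → ℝ) :
    softmaxPolicy θ ∈ policySet S A 0 :=
  fun s => ⟨fun a => (softmaxPolicy_pos θ s a).le, sum_softmaxPolicy θ s⟩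

theorem log_softmaxPolicy [Nonempty A] (θ : S → A → ℝ) (s : S) (a : A) :
    Real.log (softmaxPolicy θ s a) = θ s a - Real.log (∑ b, Real.exp (θ s b)) := by
  rw [softmaxPolicy, Real.log_div (Real.exp_pos _).ne' (sum_exp_pos _).ne', Real.log_exp]

/-- From `log x ≥ 1 - 1 / x`, each summand is at least `P a - q a`. -/
theorem finKL_nonneg {P q : A → ℝ} (hP : ∀ a, 0 ≤ P a) (hP1 : ∑ a, P a = 1)
    (hq : ∀ a, 0 < q a) (hq1 : ∑ a, q a = 1) : 0 ≤ finKL P q := by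
  have h : ∑ a, (P a - q a) ≤ finKL P q := by
    refine Finset.sum_le_sum fun a _ => ?_
    rcases (hP a).eq_or_lt with h0 | h0
    · rw [← h0]; simpa using (hq a).le
    · have h1 := mul_le_mul_of_nonneg_left
        (Real.one_sub_inv_le_log_of_pos (div_pos h0 (hq a))) h0.le
      refine le_trans (le_of_eq ?_) h1
      have := h0.ne'
      field_simp
  rwa [Finset.sum_sub_distrib, hP1, hq1, sub_self] at h

theorem finKL_eq_sub {P q : A → ℝ} (hq : ∀ a, 0 < q a) :
    finKL P q = ∑ a, P a * Real.log (P a) - ∑ a, P a * Real.log (q a) := by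
  rw [finKL, ← Finset.sum_sub_distrib]
  refine Finset.sum_congr rfl fun a _ => ?_
  rcases eq_or_ne (P a) 0 with h | h
  · simp [h]
  · rw [Real.log_div h (hq a).ne', mul_sub]

/-- One step of multiplicative weights decreases the divergence to a fixed distribution by the
expected advantage, up to a second-order term. -/
theorem finKL_softmaxPolicy_step [Nonempty A] {P : A → ℝ} (hP1 : ∑ a, P a = 1)
    {θ θ' : S → A → ℝ} {s : S} {X : A → ℝ} {B t : ℝ} (hX : ∀ a, X a ∈ Set.Icc 0 B)
    (hθ : ∀ a, θ' s a = θ s a + t * X a) :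
    finKL P (softmaxPolicy θ' s) + t * ∑ a, (P a - softmaxPolicy θ s a) * X a ≤
      finKL P (softmaxPolicy θ s) + t ^ 2 * B ^ 2 / 8 := by
  -- The ratio of the normalizers is the moment generating function of `X` under the old policy.
  have hZ : Real.log (∑ b, Real.exp (θ' s b)) - Real.log (∑ b, Real.exp (θ s b)) ≤
      t * ∑ a, softmaxPolicy θ s a * X a + t ^ 2 * B ^ 2 / 8 := by
    rw [← Real.log_div (sum_exp_pos _).ne' (sum_exp_pos _).ne',
      Real.log_le_iff_le_exp (div_pos (sum_exp_pos _) (sum_exp_pos _))]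
    refine le_trans (le_of_eq ?_) (sum_mul_exp_le_of_mem_Icc
      (fun a => (softmaxPolicy_pos θ s a).le) (sum_softmaxPolicy θ s) hX t)
    rw [Finset.sum_div]
    refine Finset.sum_congr rfl fun a _ => ?_
    rw [hθ, Real.exp_add, softmaxPolicy]
    ring
  rw [finKL_eq_sub (softmaxPolicy_pos θ' s), finKL_eq_sub (softmaxPolicy_pos θ s)]
  simp_rw [log_softmaxPolicy, hθ, mul_sub, mul_add, sub_mul, Finset.sum_sub_distrib,
    Finset.sum_add_distrib, ← Finset.sum_mul, hP1]
  have e : ∑ a, P a * (t * X a) = t * ∑ a, P a * X a := by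
    rw [Finset.mul_sum]; exact Finset.sum_congr rfl fun a _ => by ring
  simp only [hθ] at hZ
  rw [e]
  linarith

theorem differentiableAt_finKL {E : Type*} [NormedAddCommGroup E] [NormedSpace ℝ E] {P : A → ℝ}
    {q : E → A → ℝ} {x : E} (hq : ∀ a, DifferentiableAt ℝ (fun y => q y a) x)
    (h0 : ∀ a, q x a ≠ 0) : DifferentiableAt ℝ (fun y => finKL P (q y)) x := by
  unfold finKL
  refine DifferentiableAt.fun_sum fun a _ => ?_
  -- If `P a = 0`, the logarithm is taken at its singular point, but the summand is constantly zero.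
  rcases eq_or_ne (P a) 0 with h | h
  · simp [h]
  · simp only [div_eq_mul_inv]
    exact (((hq a).fun_inv (h0 a)).const_mul _ |>.log
      (mul_ne_zero h (inv_ne_zero (h0 a)))).const_mul _

end Softmax

/-! ### The two parametrizations of the initialization -/

namespace DecisionVariable

variable {S A : Type*} [Fintype S] [Fintype A] {ϱ : ℝ}

theorem toPolicy_mem_policySet (v : DecisionVariable) {x : EuclideanSpace ℝ (S × A)}
    (hx : x ∈ v.decisionSet S A ϱ) : v.toPolicy x ∈ policySet S A ϱ := by
  cases v
  exacts [hx, hx.2]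

/-- Regret is against decisions, while `D*²` is an infimum over policies. The logits are the
log-probabilities minus their mean, a shift that softmax ignores. -/
theorem exists_toPolicy_eq (v : DecisionVariable) [Nonempty A] (hϱ : 0 < ϱ) {φ : S → A → ℝ}
    (hφ : φ ∈ policySet S A ϱ) : ∃ x ∈ v.decisionSet S A ϱ, v.toPolicy x = φ := by
  cases v
  · exact ⟨WithLp.toLp 2 fun q => φ q.1 q.2, hφ, rfl⟩
  · set x : EuclideanSpace ℝ (S × A) := WithLp.toLp 2 fun q =>
      Real.log (φ q.1 q.2) - (∑ b, Real.log (φ q.1 b)) / Fintype.card A with hx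
    have hcard : (Fintype.card A : ℝ) ≠ 0 := by exact_mod_cast Fintype.card_ne_zero
    have hpos : ∀ s a, 0 < φ s a := fun s a => hϱ.trans_le ((hφ s).1 a)
    have h1 : logits.toPolicy x = φ := by
      funext s a
      have e : ∀ b, Real.exp (x (s, b)) =
          φ s b / Real.exp ((∑ b, Real.log (φ s b)) / Fintype.card A) := by
        intro b
        simp only [hx]
        rw [Real.exp_sub, Real.exp_log (hpos s b)]
      change Real.exp (x (s, a)) / ∑ b, Real.exp (x (s, b)) = _
      simp_rw [e]
      rw [← Finset.sum_div, (hφ s).2]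
      have := (Real.exp_pos ((∑ b, Real.log (φ s b)) / Fintype.card A)).ne'
      field_simp
    refine ⟨x, ⟨fun s => ?_, h1 ▸ hφ⟩, h1⟩
    simp only [hx]
    rw [Finset.sum_sub_distrib, Finset.sum_const, Finset.card_univ, nsmul_eq_mul]
    field_simp
    ring

theorem differentiableAt_toPolicy [Nonempty A] (v : DecisionVariable)
    (x : EuclideanSpace ℝ (S × A)) (s : S) (a : A) :
    DifferentiableAt ℝ (fun y : EuclideanSpace ℝ (S × A) => v.toPolicy y s a) x := by
  have hc : ∀ q : S × A, DifferentiableAt ℝ (fun y : EuclideanSpace ℝ (S × A) => y q) x :=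
    fun q => (EuclideanSpace.proj (𝕜 := ℝ) q).differentiableAt
  cases v
  · exact hc (s, a)
  · simp only [toPolicy, softmaxPolicy, div_eq_mul_inv]
    exact (hc (s, a)).exp.fun_mul
      ((DifferentiableAt.fun_sum fun b _ => (hc (s, b)).exp).fun_inv (sum_exp_pos _).ne')

end DecisionVariable

/-! ### The divergence potential along a natural gradient step -/

namespace CMDP

variable {S A : Type*} [Fintype S] [Fintype A] {p : ℕ}

theorem nonempty_states (C : CMDP S A p) : Nonempty S := by
  by_contra h
  rw [not_nonempty_iff] at h
  simpa using C.init_sum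

theorem nonempty_actions (C : CMDP S A p) {π : S → A → ℝ} (hπ : π ∈ policySet S A 0) :
    Nonempty A := by
  obtain ⟨s⟩ := C.nonempty_states
  by_contra h
  rw [not_nonempty_iff] at h
  simpa using (hπ s).2

variable [DecidableEq S] {γ : ℝ} (C : CMDP S A p) {π : S → A → ℝ}

theorem initLoss_nonneg (hγ₀ : 0 ≤ γ) (hγ₁ : γ < 1) (hπ : π ∈ policySet S A 0)
    {φ : S → A → ℝ} (hφ : ∀ s a, 0 < φ s a) (hφ1 : ∀ s, ∑ a, φ s a = 1) :
    0 ≤ initLoss γ C π φ :=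
  Finset.sum_nonneg fun s _ => mul_nonneg (C.visitation_nonneg hγ₀ hγ₁ hπ s)
    (finKL_nonneg (hπ s).1 (hπ s).2 (hφ s) (hφ1 s))

theorem differentiableAt_initLoss [Nonempty A] (v : DecisionVariable) {ϱ : ℝ} (hϱ : 0 < ϱ)
    {x : EuclideanSpace ℝ (S × A)} (hx : x ∈ v.decisionSet S A ϱ) :
    DifferentiableAt ℝ (fun y => initLoss γ C π (v.toPolicy y)) x := by
  unfold initLoss
  refine DifferentiableAt.fun_sum fun s _ => DifferentiableAt.const_mul ?_ _
  exact differentiableAt_finKL (fun a => v.differentiableAt_toPolicy x s a)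
    fun a => (hϱ.trans_le ((v.toPolicy_mem_policySet hx s).1 a)).ne'

variable [DecidableEq A]

/-- One natural gradient step on signal `i`, in terms of the divergence to a comparator policy. -/
theorem initLoss_step [Nonempty A] (hγ₀ : 0 ≤ γ) (hγ₁ : γ < 1) {πs : S → A → ℝ}
    (hπs : πs ∈ policySet S A 0) {θ θ' : S → A → ℝ} {i : Fin (p + 1)} {β : ℝ}
    (hθ : ∀ s a, θ' s a = θ s a + β * (actionValue γ C i (softmaxPolicy θ) s a / (1 - γ))) :
    initLoss γ C πs (softmaxPolicy θ') + β * (total γ C i πs - total γ C i (softmaxPolicy θ)) ≤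
      initLoss γ C πs (softmaxPolicy θ) + β ^ 2 / (8 * (1 - γ) ^ 4) := by
  have h1 : 0 < 1 - γ := by linarith
  have hπ := softmaxPolicy_mem_policySet θ
  have hpd := C.performance_difference hγ₀ hγ₁ hπ hπs i
  set Q := actionValue γ C i (softmaxPolicy θ) with hQ
  have hs : ∀ s, visitation γ C πs s * finKL (πs s) (softmaxPolicy θ' s) +
      β / (1 - γ) * (visitation γ C πs s * ∑ a, (πs s a - softmaxPolicy θ s a) * Q s a) ≤
      visitation γ C πs s * finKL (πs s) (softmaxPolicy θ s) +
      visitation γ C πs s * ((β / (1 - γ)) ^ 2 * (1 / (1 - γ)) ^ 2 / 8) := by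
    intro s
    have h := mul_le_mul_of_nonneg_left (finKL_softmaxPolicy_step (P := πs s) (hπs s).2
      (θ := θ) (θ' := θ') (s := s) (X := Q s) (t := β / (1 - γ))
      (fun a => C.actionValue_mem_Icc hγ₀ hγ₁ hπ i s a)
      (fun a => by rw [hθ]; ring)) (C.visitation_nonneg hγ₀ hγ₁ hπs s)
    linarith
  have hsum := Finset.sum_le_sum fun s (_ : s ∈ Finset.univ) => hs s
  simp_rw [Finset.sum_add_distrib, ← Finset.mul_sum, ← Finset.sum_mul] at hsum
  -- The factor `1 - γ` of the performance difference cancels the one in the step length; the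
  -- visitation weights sum to one.
  rw [hpd, C.sum_visitation hγ₀ hγ₁ hπs, one_mul] at hsum
  have e1 : β / (1 - γ) * ((1 - γ) * (total γ C i πs - total γ C i (softmaxPolicy θ))) =
      β * (total γ C i πs - total γ C i (softmaxPolicy θ)) := by field_simp
  have e2 : (β / (1 - γ)) ^ 2 * (1 / (1 - γ)) ^ 2 / 8 = β ^ 2 / (8 * (1 - γ) ^ 4) := by
    field_simp
  rw [e1, e2] at hsum
  exact hsum

end CMDP
-- Guarantee of a CRPO run
namespace CMDP

variable {S A : Type*} [Fintype S] [Fintype A] [DecidableEq S] [DecidableEq A] {p : ℕ}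
  {γ α η : ℝ} {M : ℕ} {C : CMDP S A p} {φ : S → A → ℝ} {θ : ℕ → S → A → ℝ}
  {sel : ℕ → Fin (p + 1)}

/-- Advantage of the comparator on the signal that a step of the run works on. -/
noncomputable def stepGain (γ : ℝ) (C : CMDP S A p) (πs : S → A → ℝ) (θ : ℕ → S → A → ℝ)
    (sel : ℕ → Fin (p + 1)) (m : ℕ) : ℝ :=
  (if sel m = 0 then 1 else -1) *
    (total γ C (sel m) πs - total γ C (sel m) (softmaxPolicy (θ m)))

/-- Telescoping of `initLoss_step`; the sign of the step disappears in the second-order term. -/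
theorem IsCRPORun.sum_stepGain_le [Nonempty A] (hγ₀ : 0 ≤ γ) (hγ₁ : γ < 1)
    (h : IsCRPORun γ C α η M φ θ sel) {πs : S → A → ℝ} (hπs : πs ∈ policySet S A 0)
    (n : ℕ) (hn : n ≤ M) :
    initLoss γ C πs (softmaxPolicy (θ n)) + α * ∑ m ∈ Finset.range n, stepGain γ C πs θ sel m ≤
      initLoss γ C πs φ + n * (α ^ 2 / (8 * (1 - γ) ^ 4)) := by
  induction n with
  | zero => simp [h.start]
  | succ n ih =>
    have h1 := ih (by omega)
    have h2 := C.initLoss_step hγ₀ hγ₁ hπs (h.step n (by omega))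
    have h3 : ((if sel n = 0 then (1 : ℝ) else -1) * α) ^ 2 = α ^ 2 := by
      split_ifs <;> ring
    rw [h3] at h2
    rw [Finset.sum_range_succ, stepGain]
    push_cast
    linarith

/-- Guarantee of a run whose tolerance dominates the initial divergence to a feasible comparator
plus the accumulated second-order terms. -/
theorem IsCRPORun.guarantee [Nonempty A] (hγ₀ : 0 ≤ γ) (hγ₁ : γ < 1) (hα : 0 < α) (hM : 0 < M)
    (h : IsCRPORun γ C α η M φ θ sel) {πs : S → A → ℝ} (hπs : IsFeasible γ C πs)
    (hη : initLoss γ C πs φ + M * (α ^ 2 / (8 * (1 - γ) ^ 4)) ≤ α * (M * η)) :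
    (rewardSteps M sel).Nonempty ∧
      total γ C 0 πs - outputTotal γ C M θ sel 0 ≤ η ∧
      ∀ j : Fin p, outputTotal γ C M θ sel j.succ - C.limit j ≤ η := by
  have hloss : 0 ≤ initLoss γ C πs (softmaxPolicy (θ M)) :=
    C.initLoss_nonneg hγ₀ hγ₁ hπs.1 (softmaxPolicy_pos _) (sum_softmaxPolicy _)
  have hsum : ∑ m ∈ Finset.range M, stepGain γ C πs θ sel m ≤ M * η := by
    have := h.sum_stepGain_le hγ₀ hγ₁ hπs.1 M le_rfl
    exact le_of_mul_le_mul_left (by linarith) hα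
  -- The comparator meets the limit that the iterate exceeds by more than `η`.
  have hcost : ∀ m < M, sel m ≠ 0 → η < stepGain γ C πs θ sel m := by
    intro m hm h0
    rcases h.select m hm with ⟨h1, -⟩ | ⟨j, hj, hlt⟩
    · exact absurd h1 h0
    · have := hπs.2 j
      rw [stepGain, if_neg h0, hj]
      linarith
  have hne : (rewardSteps M sel).Nonempty := by
    by_contra hemp
    rw [Finset.not_nonempty_iff_eq_empty] at hemp
    have h0 : ∀ m < M, sel m ≠ 0 := fun m hm h0 =>
      Finset.notMem_empty m (hemp ▸ Finset.mem_filter.2 ⟨Finset.mem_range.2 hm, h0⟩)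
    have hlt := Finset.sum_lt_sum_of_nonempty (Finset.nonempty_range_iff.2 hM.ne')
      fun m hm => hcost m (Finset.mem_range.1 hm) (h0 m (Finset.mem_range.1 hm))
    rw [Finset.sum_const, Finset.card_range, nsmul_eq_mul] at hlt
    linarith
  have hk : (0 : ℝ) < ((rewardSteps M sel).card : ℝ) := by exact_mod_cast hne.card_pos
  refine ⟨hne, ?_, fun j => ?_⟩
  -- The cost steps use up at least `η` each of the budget `M * η`, leaving at most `η` per reward
  -- step.
  · have hsplit := Finset.sum_filter_add_sum_filter_not (Finset.range M) (fun m => sel m = 0)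
      (stepGain γ C πs θ sel)
    have hcard := Finset.sum_filter_add_sum_filter_not (Finset.range M) (fun m => sel m = 0)
      (fun _ => η)
    have hnot : ∑ m ∈ (Finset.range M).filter (fun m => ¬ sel m = 0), η ≤
        ∑ m ∈ (Finset.range M).filter (fun m => ¬ sel m = 0), stepGain γ C πs θ sel m :=
      Finset.sum_le_sum fun m hm => by
        rw [Finset.mem_filter, Finset.mem_range] at hm
        exact (hcost m hm.1 hm.2).le
    have hrew : ∑ m ∈ (Finset.range M).filter (fun m => sel m = 0), stepGain γ C πs θ sel m =
        (rewardSteps M sel).card * total γ C 0 πs -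
          ∑ m ∈ rewardSteps M sel, total γ C 0 (softmaxPolicy (θ m)) := by
      rw [← nsmul_eq_mul, ← Finset.sum_const, ← Finset.sum_sub_distrib]
      refine Finset.sum_congr rfl fun m hm => ?_
      have h0 := (Finset.mem_filter.1 hm).2
      rw [stepGain, if_pos h0, h0, one_mul]
    have hconst : ∑ m ∈ (Finset.range M).filter (fun m => sel m = 0), η =
        (rewardSteps M sel).card * η := by
      rw [Finset.sum_const, nsmul_eq_mul]; rfl
    rw [Finset.sum_const (s := Finset.range M), Finset.card_range, nsmul_eq_mul] at hcard
    rw [outputTotal, sub_le_iff_le_add, ← sub_le_iff_le_add', le_div_iff₀ hk]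
    linarith
  · rw [outputTotal, sub_le_iff_le_add, div_le_iff₀ hk, mul_comm, ← nsmul_eq_mul]
    refine Finset.sum_le_card_nsmul _ _ _ fun m hm => ?_
    obtain ⟨hm, h0⟩ := Finset.mem_filter.1 hm
    rcases h.select m (Finset.mem_range.1 hm) with ⟨-, h1⟩ | ⟨j', hj', -⟩
    · linarith [h1 j]
    · exact absurd (h0 ▸ hj') (Fin.succ_ne_zero j').symm

end CMDP

/-! ### Choice of the learning rate and of the horizon factor -/

theorem rpow_three_halves_sq {x : ℝ} (hx : 0 ≤ x) : (x ^ (3 / 2 : ℝ)) ^ 2 = x ^ 3 := by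
  rw [← Real.rpow_natCast, ← Real.rpow_mul hx, ← Real.rpow_natCast]
  norm_num

section Rate

variable {γ X : ℝ} {M nS nA : ℕ}

theorem crpoRate_pos (hγ₁ : γ < 1) (hM : 0 < M) (hS : 0 < nS) (hA : 0 < nA) (hX : 0 < X) :
    0 < crpoRate γ M nS nA X := by
  have h1 : 0 < 1 - γ := by linarith
  unfold crpoRate
  positivity

/-- The rate balances the second-order term against the bound `X` on the average initial loss. -/
theorem crpoRate_sq (hγ₁ : γ < 1) (hM : 0 < M) (hS : 0 < nS) (hA : 0 < nA) (hX : 0 < X) :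
    2 * M * crpoRate γ M nS nA X ^ 2 * nS * nA / (1 - γ) ^ 3 = X := by
  have h1 : 0 < 1 - γ := by linarith
  rw [crpoRate, mul_pow, div_pow, rpow_three_halves_sq h1.le, Real.sq_sqrt (by positivity),
    Real.sq_sqrt hX.le]
  field_simp

theorem div_crpoRate (hγ₁ : γ < 1) (hM : 0 < M) (hS : 0 < nS) (hA : 0 < nA) (hX : 0 < X) :
    1 / (crpoRate γ M nS nA X * M) * (2 * X) = √(8 * nS * nA / (M * (1 - γ) ^ 3)) * √X := by
  have h1 : 0 < 1 - γ := by linarith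
  have hg : 0 < (1 - γ) ^ (3 / 2 : ℝ) := by positivity
  have hsq : √(8 * nS * nA / (M * (1 - γ) ^ 3)) =
      2 * √(2 * M * nS * nA) / ((1 - γ) ^ (3 / 2 : ℝ) * M) := by
    rw [Real.sqrt_eq_iff_eq_sq (by positivity) (by positivity), div_pow, mul_pow, mul_pow,
      rpow_three_halves_sq h1.le, Real.sq_sqrt (by positivity)]
    field_simp
    ring
  have hX' : X = √X * √X := (Real.mul_self_sqrt hX.le).symm
  have hX0 : √X ≠ 0 := (Real.sqrt_pos.2 hX).ne'
  rw [hsq, crpoRate]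
  nth_rewrite 2 [hX']
  field_simp

/-- The Hoeffding term carries `(1 - γ)⁻⁴`, the tolerance only `(1 - γ)⁻³`. Their ratio is the
second argument of the maximum in `horizonFactor`. -/
theorem second_order_le_horizonFactor {α : ℝ} (hγ₁ : γ < 1) (hS : 0 < nS) (hA : 0 < nA) :
    M * (α ^ 2 / (8 * (1 - γ) ^ 4)) ≤
      horizonFactor γ nS nA * (2 * M * α ^ 2 * nS * nA / (1 - γ) ^ 3) := by
  have h1 : 0 < 1 - γ := by linarith
  calc M * (α ^ 2 / (8 * (1 - γ) ^ 4)) =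
      1 / (16 * nS * nA * (1 - γ)) * (2 * M * α ^ 2 * nS * nA / (1 - γ) ^ 3) := by
        field_simp; ring
    _ ≤ _ := by
        gcongr
        exact le_max_right _ _

end Rate

/-! ### Combination of regret and within-task guarantee -/

/-- The average of the initial losses is at most the similarity scale. -/
theorem average_initLoss_le {S A : Type*} [Fintype S] [DecidableEq S] [Fintype A] [DecidableEq A]
    [Nonempty A] {p T : ℕ} (hT : 0 < T) {γ : ℝ} {C : Fin T → CMDP S A p}
    {πs : Fin T → S → A → ℝ} {ϱ L μ : ℝ} (hϱ : 0 < ϱ) (hμ : 0 < μ) (v : DecisionVariable)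
    (hgrad : ∀ t, ∀ x ∈ v.decisionSet S A ϱ,
      ‖gradient (fun y => CMDP.initLoss γ (C t) (πs t) (v.toPolicy y)) x‖ ≤ L)
    (hconv : ∀ t, StrongConvexOn (v.decisionSet S A ϱ) μ
      (fun y => CMDP.initLoss γ (C t) (πs t) (v.toPolicy y)))
    {x : Fin T → EuclideanSpace ℝ (S × A)} (hxK : ∀ t, x t ∈ v.decisionSet S A ϱ)
    (hx : IsOGD (v.decisionSet S A ϱ)
        (fun t y => CMDP.initLoss γ (C t) (πs t) (v.toPolicy y)) μ x ∨
      ∃ R : EuclideanSpace ℝ (S × A) → ℝ,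
        ConvexOn ℝ (v.decisionSet S A ϱ) R ∧
        (∀ y ∈ v.decisionSet S A ϱ, ∀ z ∈ v.decisionSet S A ϱ,
          R y - R z ≤ L ^ 2 * (Real.log T + 1) / (2 * μ)) ∧
        IsFTRL (v.decisionSet S A ϱ)
          (fun t y => CMDP.initLoss γ (C t) (πs t) (v.toPolicy y)) R x) :
    1 / (T : ℝ) * ∑ t, CMDP.initLoss γ (C t) (πs t) (v.toPolicy (x t)) ≤
      similarityScale T L μ (CMDP.taskSimilaritySq γ ϱ C πs) := by
  have hT' : (0 : ℝ) < T := by exact_mod_cast hT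
  have : Nonempty (policySet S A ϱ) := ⟨⟨_, v.toPolicy_mem_policySet (hxK ⟨0, hT⟩)⟩⟩
  rw [similarityScale, ← sub_le_iff_le_add']
  -- Comparing with every `φ` separately avoids having to attain the infimum.
  refine le_ciInf fun φ => ?_
  obtain ⟨y, hy, hyφ⟩ := v.exists_toPolicy_eq hϱ φ.2
  have h := meta_regret hT hμ
    (fun t z hz => (C t).differentiableAt_initLoss (π := πs t) v hϱ hz) hgrad hconv hx hy
  simp only [hyφ] at h
  have h' := mul_le_mul_of_nonneg_left h (one_div_pos.2 hT').le
  have e : 1 / (T : ℝ) * (L ^ 2 * (Real.log T + 1) / μ) =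
      L ^ 2 * (Real.log T + 1) / (μ * T) := by field_simp
  rw [mul_add, e] at h'
  linarith

theorem lemma1 {S A : Type*} [Fintype S] [DecidableEq S] [Fintype A] [DecidableEq A]
    {p T M : ℕ} (hT : 0 < T) (hM : 0 < M) (γ : ℝ) (hγ₀ : 0 ≤ γ) (hγ₁ : γ < 1)
    -- the tasks and their optimal policies
    (C : Fin T → CMDP S A p) (πs : Fin T → S → A → ℝ)
    (hπs : ∀ t, CMDP.IsOptimal γ (C t) (πs t))
    -- shrinkage parameter, gradient bound and strong convexity parameter of the meta-losses
    (ϱ L μ : ℝ) (hϱ : 0 < ϱ) (hL : 0 < L) (hμ : 0 < μ) (v : DecisionVariable)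
    (hgrad : ∀ t, ∀ x ∈ v.decisionSet S A ϱ,
      ‖gradient (fun y => CMDP.initLoss γ (C t) (πs t) (v.toPolicy y)) x‖ ≤ L)
    (hconv : ∀ t, StrongConvexOn (v.decisionSet S A ϱ) μ
      (fun y => CMDP.initLoss γ (C t) (πs t) (v.toPolicy y)))
    -- the initializations are played by OGD or by FTRL
    (x : Fin T → EuclideanSpace ℝ (S × A))
    (hx : IsOGD (v.decisionSet S A ϱ)
        (fun t y => CMDP.initLoss γ (C t) (πs t) (v.toPolicy y)) μ x ∨
      ∃ R : EuclideanSpace ℝ (S × A) → ℝ,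
        ConvexOn ℝ (v.decisionSet S A ϱ) R ∧
        (∀ y ∈ v.decisionSet S A ϱ, ∀ z ∈ v.decisionSet S A ϱ,
          R y - R z ≤ L ^ 2 * (Real.log T + 1) / (2 * μ)) ∧
        IsFTRL (v.decisionSet S A ϱ)
          (fun t y => CMDP.initLoss γ (C t) (πs t) (v.toPolicy y)) R x)
    -- learning rate and tolerances
    (α : ℝ)
    (hα : α = crpoRate γ M (Fintype.card S) (Fintype.card A)
      (similarityScale T L μ (CMDP.taskSimilaritySq γ ϱ C πs)))
    (η : Fin T → ℝ)
    (hη : ∀ t, η t = crpoTolerance γ α M (Fintype.card S) (Fintype.card A)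
      (CMDP.initLoss γ (C t) (πs t) (v.toPolicy (x t))))
    -- the within-task runs of CRPO
    (θ : Fin T → ℕ → S → A → ℝ) (sel : Fin T → ℕ → Fin (p + 1))
    (hrun : ∀ t, CMDP.IsCRPORun γ (C t) α (η t) M (v.toPolicy (x t)) (θ t) (sel t)) :
    (∀ t, (CMDP.rewardSteps M (sel t)).Nonempty) ∧
    CMDP.taog γ C πs M θ sel ≤
      horizonFactor γ (Fintype.card S) (Fintype.card A) *
        (√(8 * Fintype.card S * Fintype.card A / (M * (1 - γ) ^ 3)) *
          √(similarityScale T L μ (CMDP.taskSimilaritySq γ ϱ C πs))) ∧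
    ∀ j : Fin p, CMDP.tacv γ C M θ sel j ≤
      horizonFactor γ (Fintype.card S) (Fintype.card A) *
        (√(8 * Fintype.card S * Fintype.card A / (M * (1 - γ) ^ 3)) *
          √(similarityScale T L μ (CMDP.taskSimilaritySq γ ϱ C πs))) := by
  have hT' : (0 : ℝ) < T := by exact_mod_cast hT
  have hM' : (0 : ℝ) < M := by exact_mod_cast hM
  have : Nonempty S := (C ⟨0, hT⟩).nonempty_states
  have : Nonempty A := (C ⟨0, hT⟩).nonempty_actions (hπs ⟨0, hT⟩).1.1
  have hS : 0 < Fintype.card S := Fintype.card_pos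
  have hA : 0 < Fintype.card A := Fintype.card_pos
  have hxK : ∀ t, x t ∈ v.decisionSet S A ϱ := by
    rcases hx with h | ⟨R, -, -, h⟩
    exacts [h.1, fun t => (h t).1]
  set X := similarityScale T L μ (CMDP.taskSimilaritySq γ ϱ C πs) with hXdef
  set κ := horizonFactor γ (Fintype.card S) (Fintype.card A) with hκ
  have hκ1 : 1 ≤ κ := le_max_left _ _
  have hsim : 0 ≤ CMDP.taskSimilaritySq γ ϱ C πs :=
    Real.iInf_nonneg fun φ => mul_nonneg (by positivity) <| Finset.sum_nonneg fun t _ =>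
      (C t).initLoss_nonneg hγ₀ hγ₁ (hπs t).1.1
        (fun s a => hϱ.trans_le ((φ.2 s).1 a)) fun s => (φ.2 s).2
  have hX : 0 < X := by
    have := Real.log_natCast_nonneg T
    exact add_pos_of_pos_of_nonneg (by positivity) hsim
  have hα0 : 0 < α := hα ▸ crpoRate_pos hγ₁ hM hS hA hX
  have hαX : 2 * M * α ^ 2 * Fintype.card S * Fintype.card A / (1 - γ) ^ 3 = X :=
    hα ▸ crpoRate_sq hγ₁ hM hS hA hX
  have htask := fun t => (hrun t).guarantee hγ₀ hγ₁ hα0 hM (hπs t).1 (by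
    have h1 : α * (M * η t) = CMDP.initLoss γ (C t) (πs t) (v.toPolicy (x t)) +
        κ * (2 * M * α ^ 2 * Fintype.card S * Fintype.card A / (1 - γ) ^ 3) := by
      rw [hη t, crpoTolerance]
      rw [hκ]
      field_simp
    rw [h1]
    refine add_le_add_right ?_ _
    exact second_order_le_horizonFactor hγ₁ hS hA)
  have hηavg : 1 / (T : ℝ) * ∑ t, η t ≤
      κ * (√(8 * Fintype.card S * Fintype.card A / (M * (1 - γ) ^ 3)) * √X) := by
    have havg := average_initLoss_le hT hϱ hμ v hgrad hconv hxK hx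
    rw [← hXdef] at havg
    have h1 : 1 / (T : ℝ) * ∑ t, η t = 1 / (α * M) *
        (1 / (T : ℝ) * ∑ t, CMDP.initLoss γ (C t) (πs t) (v.toPolicy (x t)) + κ * X) := by
      simp_rw [hη, crpoTolerance, hαX]
      rw [← Finset.mul_sum, Finset.sum_add_distrib, Finset.sum_const, Finset.card_univ,
        Fintype.card_fin, nsmul_eq_mul]
      rw [hκ]
      field_simp
    -- What remains is that the average loss plus `κ X` is at most `2 κ X`, by `havg` and `1 ≤ κ`.
    rw [h1, ← div_crpoRate hγ₁ hM hS hA hX, ← hα, mul_left_comm]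
    gcongr
    nlinarith
  refine ⟨fun t => (htask t).1, le_trans ?_ hηavg, fun j => le_trans ?_ hηavg⟩
  · exact mul_le_mul_of_nonneg_left (Finset.sum_le_sum fun t _ => (htask t).2.1) (by positivity)
  · exact mul_le_mul_of_nonneg_left (Finset.sum_le_sum fun t _ => (htask t).2.2 j) (by positivity)
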